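/- Let $\mathbb K$ be a field, $d\ge 0$ an integer, $\mathcal A$ a $\mathbb K$-algebra isomorphic to $\mathrm{Mat}_{d+1}(\mathbb K)$, and $V$ a simple left $\mathcal A$-module. An element of $\mathcal A$ is multiplicity-free if it has $d+1$ mutually distinct eigenvalues in $\mathbb K$; if $A$ is multiplicity-free and $\theta_0,\dots,\theta_d$ is an ordering of its eigenvalues, then its primitive idempotents are $E_i=\prod_{j\ne i}\frac{A-\theta_jI}{\theta_i-\theta_j}$. Let $\Phi=(A;\{E_i\}_{i=0}^d;A^*;\{E^*_i\}_{i=0}^d)$ be a Leonard system in $\mathcal A$. This means that $A,A^*\in\mathcal A$ are multiplicity-free, that $\{E_i\}$ and $\{E_i^*\}$ are orderings of the primitive idempotents of $A$ and $A^*$ (for the eigenvalues $\theta_i$ and $\theta^*_i$, respectively), and that each of $E_iA^*E_j$ and $E^*_iAE^*_j$ is $0$ if $|i-j|>1$ and nonzero if $|i-j|=1$. Put $\tau_i=\prod_{h=0}^{i-1}(\lambda-\theta_h)$ and $\eta_i=\prod_{h=0}^{i-1}(\lambda-\theta_{d-h})$. The first and second split sequences of $\Phi$ are $$\varphi_i=(\theta^*_0-\theta^*_i)\frac{\mathrm{tr}(\tau_i(A)E^*_0)}{\mathrm{tr}(\tau_{i-1}(A)E^*_0)},\qquad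 \phi_i=(\theta^*_0-\theta^*_i)\frac{\mathrm{tr}(\eta_i(A)E^*_0)}{\mathrm{tr}(\eta_{i-1}(A)E^*_0)}\qquad(1\le i\le d).$$ The switching element of $\Phi$ is $$S=\sum_{r=0}^d\frac{\phi_d\phi_{d-1}\cdots\phi_{d-r+1}}{\varphi_1\varphi_2\cdots\varphi_r}E_r,$$ and the dual switching element $S^*$ is the switching element of the Leonard system $(A^*;\{E^*_i\};A;\{E_i\})$. Define four sequences of subspaces of $V$ by giving their $i$-th components for $0\le i\le d$: $$[0]:\ E_0V+\cdots+E_iV,\quad [D]:\ E_dV+\cdots+E_{d-i}V,\quad [0^*]:\ E^*_0V+\cdots+E^*_iV,\quad [D^*]:\ E^*_dV+\cdots+E^*_{d-i}V.$$ For distinct $z,w\in\{0,D,0^*,D^*\}$ let the $i$-th component of $[zw]$ be the intersection of the $i$-th component of $[z]$ and the $(d-i)$-th component of $[w]$. Theorem. For each $[zw]$ among $[0^*D]$, $[D^*D]$, $[0^*0]$, $[D^*0]$ the components $U_0,\dots,U_d$ of $[zw]$ are one-dimensional and $V$ is their direct sum; moreover, for $0\le i\le d$, the $i$-th component of $[z]$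 is $U_0+\cdots+U_i$ and that of $[w]$ is $U_d+\cdots+U_{d-i}$. The elements $S$ and $S^*$ are invertible, and for $0\le i\le d$ the following hold. (i) $S^*S^{-1}S^{*-1}S$ acts on the $i$-th component of $[0^*D]$ as the scalar $$\frac{\phi_1\cdots\phi_i}{\varphi_1\cdots\varphi_i}\cdot\frac{\varphi_1\cdots\varphi_{d-i}}{\phi_1\cdots\phi_{d-i}}.$$ (ii) $S^*SS^{*-1}S^{-1}$ acts on the $i$-th component of $[D^*D]$ as the scalar $$\frac{\varphi_d\varphi_{d-1}\cdots\varphi_{d-i+1}}{\phi_d\phi_{d-1}\cdots\phi_{d-i+1}}\cdot\frac{\phi_d\phi_{d-1}\cdots\phi_{i+1}}{\varphi_d\varphi_{d-1}\cdots\varphi_{i+1}}.$$ (iii) $S^{*-1}S^{-1}S^*S$ acts on the $i$-th component of $[0^*0]$ as the scalar $$\frac{\varphi_1\cdots\varphi_i}{\phi_1\cdots\phi_i}\cdot\frac{\phi_1\cdots\phi_{d-i}}{\varphi_1\cdots\varphi_{d-i}}.$$ (iv) $S^{*-1}SS^*S^{-1}$ acts on the $i$-th component of $[D^*0]$ as the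 scalar $$\frac{\phi_d\phi_{d-1}\cdots\phi_{d-i+1}}{\varphi_d\varphi_{d-1}\cdots\varphi_{d-i+1}}\cdot\frac{\varphi_d\varphi_{d-1}\cdots\varphi_{i+1}}{\phi_d\phi_{d-1}\cdots\phi_{i+1}}.$$ -/

import Mathlib

open scoped Polynomial

noncomputable section

/-- `θ` is an ordering of the eigenvalues of the multiplicity-free element `A`: the `d + 1` scalars
`θ 0, …, θ d` of `K` are mutually distinct and are precisely the eigenvalues of `A`. -/
def IsEigenvalueOrdering {K 𝒜 : Type*} [Field K] [Ring 𝒜] [Algebra K 𝒜] {d : ℕ}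
    (A : 𝒜) (θ : Fin (d + 1) → K) : Prop :=
  Function.Injective θ ∧ Set.range θ = spectrum K A

/-- The primitive idempotent of `A` associated with `θ i`, namely
`∏_{j ≠ i} (A - θ_j I) / (θ_i - θ_j)`. -/
def primitiveIdempotent {K 𝒜 : Type*} [Field K] [Ring 𝒜] [Algebra K 𝒜] {d : ℕ}
    (A : 𝒜) (θ : Fin (d + 1) → K) (i : Fin (d + 1)) : 𝒜 :=
  Polynomial.aeval A
    (∏ j ∈ Finset.univ.erase i,
      (Polynomial.C (θ i - θ j)⁻¹ * (Polynomial.X - Polynomial.C (θ j)) : K[X]))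

/-- A Leonard system `(A; {E_i}; A*; {E*_i})` of diameter `d` in the `K`-algebra `𝒜` (which will be
isomorphic to the algebra of `(d + 1) × (d + 1)` matrices). The eigenvalue sequence `θ` and the dual
eigenvalue sequence `θs` are recorded too; they are determined by `A`, `E`, `As`, `Es`. -/
structure LeonardSystem (K 𝒜 : Type*) [Field K] [Ring 𝒜] [Algebra K 𝒜] (d : ℕ) where
  /-- the element `A` -/
  A : 𝒜
  /-- the primitive idempotents `E_i` of `A` -/
  E : Fin (d + 1) → 𝒜
  /-- the element `A*` -/
  As : 𝒜
  /-- the primitive idempotents `E*_i` of `A*` -/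
  Es : Fin (d + 1) → 𝒜
  /-- the eigenvalue sequence `θ_i` -/
  θ : Fin (d + 1) → K
  /-- the dual eigenvalue sequence `θ*_i` -/
  θs : Fin (d + 1) → K
  eigenvalues : IsEigenvalueOrdering A θ
  dual_eigenvalues : IsEigenvalueOrdering As θs
  E_eq : ∀ i, E i = primitiveIdempotent A θ i
  Es_eq : ∀ i, Es i = primitiveIdempotent As θs i
  E_As_E_eq_zero : ∀ i j : Fin (d + 1), 1 < |(i : ℤ) - (j : ℤ)| → E i * As * E j = 0
  E_As_E_ne_zero : ∀ i j : Fin (d + 1), |(i : ℤ) - (j : ℤ)| = 1 → E i * As * E j ≠ 0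
  Es_A_Es_eq_zero : ∀ i j : Fin (d + 1), 1 < |(i : ℤ) - (j : ℤ)| → Es i * A * Es j = 0
  Es_A_Es_ne_zero : ∀ i j : Fin (d + 1), |(i : ℤ) - (j : ℤ)| = 1 → Es i * A * Es j ≠ 0

namespace LeonardSystem

/-- The Leonard system `Φ* = (A*; {E*_i}; A; {E_i})`. -/
def dual {K 𝒜 : Type*} [Field K] [Ring 𝒜] [Algebra K 𝒜] {d : ℕ}
    (Φ : LeonardSystem K 𝒜 d) : LeonardSystem K 𝒜 d where
  A := Φ.As
  E := Φ.Es
  As := Φ.A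
  Es := Φ.E
  θ := Φ.θs
  θs := Φ.θ
  eigenvalues := Φ.dual_eigenvalues
  dual_eigenvalues := Φ.eigenvalues
  E_eq := Φ.Es_eq
  Es_eq := Φ.E_eq
  E_As_E_eq_zero := Φ.Es_A_Es_eq_zero
  E_As_E_ne_zero := Φ.Es_A_Es_ne_zero
  Es_A_Es_eq_zero := Φ.E_As_E_eq_zero
  Es_A_Es_ne_zero := Φ.E_As_E_ne_zero

/-- `τ_i = (λ - θ_0)(λ - θ_1) ⋯ (λ - θ_{i-1})`, for `0 ≤ i ≤ d`. -/
def τ {K 𝒜 : Type*} [Field K] [Ring 𝒜] [Algebra K 𝒜] {d : ℕ}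
    (Φ : LeonardSystem K 𝒜 d) (i : ℕ) : K[X] :=
  ∏ h ∈ Finset.range i, (Polynomial.X - Polynomial.C (Φ.θ (Fin.ofNat (d + 1) h)))

/-- `η_i = (λ - θ_d)(λ - θ_{d-1}) ⋯ (λ - θ_{d-i+1})`, for `0 ≤ i ≤ d`. -/
def η {K 𝒜 : Type*} [Field K] [Ring 𝒜] [Algebra K 𝒜] {d : ℕ}
    (Φ : LeonardSystem K 𝒜 d) (i : ℕ) : K[X] :=
  ∏ h ∈ Finset.range i, (Polynomial.X - Polynomial.C (Φ.θ (Fin.ofNat (d + 1) (d - h))))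

/-- The first split sequence
`φ_i = (θ*_0 - θ*_i) tr(τ_i(A) E*_0) / tr(τ_{i-1}(A) E*_0)`, for `1 ≤ i ≤ d`.
The trace of an element of `𝒜` is the trace of the matrix that corresponds to it under an
isomorphism `e` of `𝒜` with the full matrix algebra; it does not depend on `e`. -/
def firstSplit {K 𝒜 : Type*} [Field K] [Ring 𝒜] [Algebra K 𝒜] {d : ℕ}
    (Φ : LeonardSystem K 𝒜 d) (e : 𝒜 ≃ₐ[K] Matrix (Fin (d + 1)) (Fin (d + 1)) K) (i : ℕ) : K :=
  (Φ.θs 0 - Φ.θs (Fin.ofNat (d + 1) i)) *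
    ((e (Polynomial.aeval Φ.A (Φ.τ i) * Φ.Es 0)).trace /
      (e (Polynomial.aeval Φ.A (Φ.τ (i - 1)) * Φ.Es 0)).trace)

/-- The second split sequence
`ϕ_i = (θ*_0 - θ*_i) tr(η_i(A) E*_0) / tr(η_{i-1}(A) E*_0)`, for `1 ≤ i ≤ d`. -/
def secondSplit {K 𝒜 : Type*} [Field K] [Ring 𝒜] [Algebra K 𝒜] {d : ℕ}
    (Φ : LeonardSystem K 𝒜 d) (e : 𝒜 ≃ₐ[K] Matrix (Fin (d + 1)) (Fin (d + 1)) K) (i : ℕ) : K :=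
  (Φ.θs 0 - Φ.θs (Fin.ofNat (d + 1) i)) *
    ((e (Polynomial.aeval Φ.A (Φ.η i) * Φ.Es 0)).trace /
      (e (Polynomial.aeval Φ.A (Φ.η (i - 1)) * Φ.Es 0)).trace)

/-- The switching element
`S = ∑_{r=0}^{d} (ϕ_d ϕ_{d-1} ⋯ ϕ_{d-r+1}) / (φ_1 φ_2 ⋯ φ_r) E_r`. -/
def switching {K 𝒜 : Type*} [Field K] [Ring 𝒜] [Algebra K 𝒜] {d : ℕ}
    (Φ : LeonardSystem K 𝒜 d) (e : 𝒜 ≃ₐ[K] Matrix (Fin (d + 1)) (Fin (d + 1)) K) : 𝒜 :=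
  ∑ r : Fin (d + 1),
    ((∏ h ∈ Finset.Icc (d - (r : ℕ) + 1) d, Φ.secondSplit e h) /
      (∏ h ∈ Finset.Icc 1 (r : ℕ), Φ.firstSplit e h)) • Φ.E r

/-- The dual switching element `S*`, i.e. the switching element of `Φ*`. -/
def dualSwitching {K 𝒜 : Type*} [Field K] [Ring 𝒜] [Algebra K 𝒜] {d : ℕ}
    (Φ : LeonardSystem K 𝒜 d) (e : 𝒜 ≃ₐ[K] Matrix (Fin (d + 1)) (Fin (d + 1)) K) : 𝒜 :=
  Φ.dual.switching e

end LeonardSystem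

/-- The subspace `X V = {X v : v ∈ V}` for an element `X` of an algebra acting on `V`. -/
def imageSubspace {K 𝒜 : Type*} [Field K] [Ring 𝒜] [Algebra K 𝒜]
    (V : Type*) [AddCommGroup V] [Module K V] [Module 𝒜 V] [IsScalarTower K 𝒜 V]
    (X : 𝒜) : Submodule K V :=
  LinearMap.range (Algebra.lsmul K K V X)

/-- The four symbols `0, D, 0*, D*` that label the flags. -/
inductive FlagLabel
  | zero
  | D
  | zeroStar
  | DStar

namespace LeonardSystem

/-- The `i`-th component of the flag `[z]`:
`E_0V + ⋯ + E_iV` for `0`, `E_dV + ⋯ + E_{d-i}V` for `D`, and the same with `E*` for `0*`, `D*`. -/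
def flag {K 𝒜 : Type*} [Field K] [Ring 𝒜] [Algebra K 𝒜] {d : ℕ} (Φ : LeonardSystem K 𝒜 d)
    (V : Type*) [AddCommGroup V] [Module K V] [Module 𝒜 V] [IsScalarTower K 𝒜 V]
    (z : FlagLabel) (i : Fin (d + 1)) : Submodule K V :=
  match z with
  | .zero => ⨆ j ∈ Set.Iic i, imageSubspace V (Φ.E j)
  | .D => ⨆ j ∈ Set.Ici i.rev, imageSubspace V (Φ.E j)
  | .zeroStar => ⨆ j ∈ Set.Iic i, imageSubspace V (Φ.Es j)
  | .DStar => ⨆ j ∈ Set.Ici i.rev, imageSubspace V (Φ.Es j)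

/-- The `i`-th component of `[zw]`: the intersection of the `i`-th component of `[z]` and the
`(d - i)`-th component of `[w]`. -/
def component {K 𝒜 : Type*} [Field K] [Ring 𝒜] [Algebra K 𝒜] {d : ℕ} (Φ : LeonardSystem K 𝒜 d)
    (V : Type*) [AddCommGroup V] [Module K V] [Module 𝒜 V] [IsScalarTower K 𝒜 V]
    (z w : FlagLabel) (i : Fin (d + 1)) : Submodule K V :=
  Φ.flag V z i ⊓ Φ.flag V w i.rev

end LeonardSystem

/-- `U` is a decomposition of `V`: the `U i` are one-dimensional subspaces with direct sum `V`. -/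
def IsDecomposition {K V : Type*} [Field K] [AddCommGroup V] [Module K V] {d : ℕ}
    (U : Fin (d + 1) → Submodule K V) : Prop :=
  (∀ i, Module.finrank K (U i) = 1) ∧ DirectSum.IsInternal U

/-- `U` is the decomposition of `V` induced by the (opposite) flags `F` and `F'`:
`F_i = U_0 + ⋯ + U_i` and `F'_i = U_d + ⋯ + U_{d-i}` for all `i`. -/
def IsInducedDecomposition {K V : Type*} [Field K] [AddCommGroup V] [Module K V] {d : ℕ}
    (F F' U : Fin (d + 1) → Submodule K V) : Prop :=
  IsDecomposition U ∧ (∀ i, F i = ⨆ j ∈ Set.Iic i, U j) ∧ (∀ i, F' i = ⨆ j ∈ Set.Ici i.rev, U j)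

/-- `X` acts on the nonzero subspace `U` as the scalar `c`, i.e. `c` is the eigenvalue of `X`
on `U`. -/
def IsEigenvalueOn {K 𝒜 V : Type*} [Field K] [Ring 𝒜] [Algebra K 𝒜]
    [AddCommGroup V] [Module K V] [Module 𝒜 V] (X : 𝒜) (U : Submodule K V) (c : K) : Prop :=
  U ≠ ⊥ ∧ ∀ v ∈ U, X • v = c • v

end

/-! Fix a nonzero `v` in $E^*_0V$. The lines of $[0^*D]$ are spanned by the vectors $\tau_i(A)v$, on
which $A$ acts by raising and $A^*$ by lowering, the latter with coefficients $\varphi_i$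
(`firstSplit_spec`). Reversing the order of the $E_i$ or of the $E^*_i$ gives the other three
decompositions from the same statements.

The element $S$ commutes with $A$ and carries $E^*_0V$ to $E^*_dV$. Hence $S\tau_i(A)v=\tau_i(A)Sv$,
so $S$ carries $[0^*D]_i$ to $[D^*D]_i$, and likewise $[0^*0]_i$ to $[D^*0]_i$. Dually, $S^*$
carries $[D^*0]_i$ to $[D^*D]_i$ and $[0^*0]_i$ to $[0^*D]_i$. The four lines of index $i$ form a
square, and each of the four products goes once around it, so it acts as a scalar. To compute the
scalar, a spanning vector of each line is written in two ways, by a polynomial in $A$ and by one in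
$A^*$ (`prod_firstSplit_smul_splitVector`); `commutator_smul_of_cycle` multiplies the resulting
ratios.

The main point is $SE^*_0V=E^*_dV$ (`exists_smul_switching_smul_eq`). The $E_r$-components of
vectors in these two lines satisfy the same kind of two-term recurrence, with different split
sequences, and the quotient of the recurrences is the one defining the coefficients of $S$. This
requires that reversing the $E^*_i$ turn the first split sequence into $\phi_d,\dots,\phi_1$
(`firstSplit_reverseE_eq`), which follows from evaluating $\mathrm{tr}(AE^*_i)$ in two ways
(`trace_A_mul_Es`). -/

noncomputable section

set_option linter.unusedSectionVars false

/-! ### Diagonalizing a multiplicity-free element. -/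

section Diagonalization

variable {K 𝒜 : Type*} [Field K] [Ring 𝒜] [Algebra K 𝒜] {d : ℕ}

/-- A multiplicity-free element becomes diagonal under a trace-preserving change of the
identification with the matrix algebra. -/
theorem IsEigenvalueOrdering.exists_diagonal {A : 𝒜} {θ : Fin (d + 1) → K}
    (h : IsEigenvalueOrdering A θ) (e : 𝒜 ≃ₐ[K] Matrix (Fin (d + 1)) (Fin (d + 1)) K) :
    ∃ f : 𝒜 ≃ₐ[K] Matrix (Fin (d + 1)) (Fin (d + 1)) K,
      f A = Matrix.diagonal θ ∧ ∀ X, (f X).trace = (e X).trace := by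
  have hev : ∀ i, Module.End.HasEigenvalue (Matrix.toLin' (e A)) (θ i) := by
    intro i
    rw [Module.End.hasEigenvalue_iff_mem_spectrum, Matrix.spectrum_toLin',
      AlgEquiv.spectrum_eq e A, ← h.2]
    exact Set.mem_range_self i
  choose b hb using fun i => (hev i).exists_hasEigenvector
  have hli : LinearIndependent K b :=
    Module.End.eigenvectors_linearIndependent' _ θ h.1 b hb
  let B : Module.Basis (Fin (d + 1)) K (Fin (d + 1) → K) :=
    basisOfLinearIndependentOfCardEqFinrank hli (by simp)
  have hB : ∀ i, B i = b i := fun i => by simp [B]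
  refine ⟨(e.trans Matrix.toLinAlgEquiv').trans (LinearMap.toMatrixAlgEquiv B), ?_, ?_⟩
  · ext i j
    have h1 : (Matrix.toLin' (e A)) (b j) = θ j • b j := (hb j).apply_eq_smul
    simp only [AlgEquiv.trans_apply, LinearMap.toMatrixAlgEquiv_apply, hB]
    change B.repr (Matrix.toLin' (e A) (b j)) i = _
    rw [h1, ← hB, map_smul, B.repr_self]
    by_cases hij : i = j
    · subst hij; simp
    · simp [Matrix.diagonal_apply_ne _ hij, Finsupp.single_eq_of_ne hij]
  · intro X
    have h1 := LinearMap.trace_eq_matrix_trace K B (Matrix.toLin' (e X))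
    rw [Matrix.trace_toLin'_eq] at h1
    exact h1.symm

theorem aeval_diagonal (θ : Fin (d + 1) → K) (p : K[X]) :
    Polynomial.aeval (Matrix.diagonal θ) p = Matrix.diagonal fun j => p.eval (θ j) := by
  have h := Polynomial.aeval_algHom_apply (Matrix.diagonalAlgHom (n := Fin (d + 1)) (α := K) K) θ p
  simp only [Matrix.diagonalAlgHom_apply] at h
  rw [h]
  congr 1
  ext j
  simp [Polynomial.coe_aeval_eq_eval]

theorem eval_primitiveIdempotent {θ : Fin (d + 1) → K} (h : Function.Injective θ)
    (i j : Fin (d + 1)) :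
    (∏ j ∈ Finset.univ.erase i,
      (Polynomial.C (θ i - θ j)⁻¹ * (Polynomial.X - Polynomial.C (θ j)) : K[X])).eval (θ j) =
      (Pi.single i 1 : Fin (d + 1) → K) j := by
  rw [Polynomial.eval_prod]
  by_cases hij : j = i
  · subst hij
    rw [Pi.single_eq_same]
    refine Finset.prod_eq_one fun k hk => ?_
    have : θ j - θ k ≠ 0 := sub_ne_zero.2 fun hh => (Finset.ne_of_mem_erase hk) (h hh).symm
    simp [this]
  · rw [Pi.single_eq_of_ne hij]
    exact Finset.prod_eq_zero (i := j) (by simp [hij]) (by simp)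

theorem map_primitiveIdempotent {A : 𝒜} {θ : Fin (d + 1) → K} (h : Function.Injective θ)
    (f : 𝒜 ≃ₐ[K] Matrix (Fin (d + 1)) (Fin (d + 1)) K) (hf : f A = Matrix.diagonal θ)
    (i : Fin (d + 1)) :
    f (primitiveIdempotent A θ i) = Matrix.single i i 1 := by
  have h1 := Polynomial.aeval_algHom_apply f.toAlgHom A
    (∏ j ∈ Finset.univ.erase i,
      (Polynomial.C (θ i - θ j)⁻¹ * (Polynomial.X - Polynomial.C (θ j)) : K[X]))
  change Polynomial.aeval (f A) _ = f _ at h1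
  rw [hf] at h1
  rw [primitiveIdempotent, ← h1, aeval_diagonal, ← Matrix.diagonal_single]
  congr 1
  ext j
  exact eval_primitiveIdempotent h i j

end Diagonalization

/-! ### Primitive idempotents and their action on the simple module. -/

namespace LeonardSystem

section Idempotents

variable {K 𝒜 : Type*} [Field K] [Ring 𝒜] [Algebra K 𝒜] {d : ℕ} (Φ : LeonardSystem K 𝒜 d)
  (e : 𝒜 ≃ₐ[K] Matrix (Fin (d + 1)) (Fin (d + 1)) K)

theorem exists_diagonal : ∃ f : 𝒜 ≃ₐ[K] Matrix (Fin (d + 1)) (Fin (d + 1)) K,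
    f Φ.A = Matrix.diagonal Φ.θ ∧ (∀ i, f (Φ.E i) = Matrix.single i i 1) ∧
      ∀ X, (f X).trace = (e X).trace := by
  obtain ⟨f, hf, ht⟩ := Φ.eigenvalues.exists_diagonal e
  refine ⟨f, hf, fun i => ?_, ht⟩
  rw [Φ.E_eq, map_primitiveIdempotent Φ.eigenvalues.1 f hf]

include e

theorem E_mul_self (i : Fin (d + 1)) : Φ.E i * Φ.E i = Φ.E i := by
  obtain ⟨f, -, hE, -⟩ := Φ.exists_diagonal e
  apply f.injective
  simp [hE]

theorem E_mul_E_of_ne {i j : Fin (d + 1)} (h : i ≠ j) : Φ.E i * Φ.E j = 0 := by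
  obtain ⟨f, -, hE, -⟩ := Φ.exists_diagonal e
  apply f.injective
  simp [hE, h]

theorem sum_E : ∑ i, Φ.E i = 1 := by
  obtain ⟨f, -, hE, -⟩ := Φ.exists_diagonal e
  apply f.injective
  simp [hE, map_sum, Matrix.sum_single_one]

theorem E_ne_zero (i : Fin (d + 1)) : Φ.E i ≠ 0 := by
  obtain ⟨f, -, hE, -⟩ := Φ.exists_diagonal e
  intro h
  have := hE i
  rw [h, map_zero] at this
  simpa using congrFun (congrFun this i) i

theorem E_mul_A (i : Fin (d + 1)) : Φ.E i * Φ.A = Φ.θ i • Φ.E i := by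
  obtain ⟨f, hA, hE, -⟩ := Φ.exists_diagonal e
  apply f.injective
  ext a b
  simp [hE, hA, Matrix.mul_diagonal, Matrix.single_apply]
  aesop

theorem A_mul_E (i : Fin (d + 1)) : Φ.A * Φ.E i = Φ.θ i • Φ.E i := by
  obtain ⟨f, hA, hE, -⟩ := Φ.exists_diagonal e
  apply f.injective
  ext a b
  simp [hE, hA, Matrix.diagonal_mul, Matrix.single_apply]
  aesop

/-- In diagonalizing coordinates `Φ.E i` is a diagonal matrix unit, so compressing by it leaves one
matrix entry. This is how traces become coefficients of vectors. -/
theorem E_mul_mul_E (X : 𝒜) (i : Fin (d + 1)) :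
    Φ.E i * X * Φ.E i = (e (X * Φ.E i)).trace • Φ.E i := by
  obtain ⟨f, -, hE, ht⟩ := Φ.exists_diagonal e
  apply f.injective
  rw [← ht]
  simp [hE, Matrix.trace_mul_single, Matrix.smul_single]

theorem sum_E_smul {V : Type*} [AddCommGroup V] [Module 𝒜 V] (x : V) : ∑ i, Φ.E i • x = x := by
  rw [← Finset.sum_smul, Φ.sum_E e, one_smul]

/-- A matrix algebra over a field is a simple ring, so its action on a nonzero module is faithful.
-/
theorem exists_smul_ne_zero {V : Type*} [AddCommGroup V] [Module 𝒜 V] [IsSimpleModule 𝒜 V]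
    {X : 𝒜} (hX : X ≠ 0) : ∃ v : V, X • v ≠ 0 := by
  have : IsSimpleRing 𝒜 := IsSimpleRing.of_ringEquiv e.symm.toRingEquiv inferInstance
  have : Nontrivial V := IsSimpleModule.nontrivial 𝒜 V
  by_contra! h
  have : Nontrivial (AddMonoid.End V) := by
    obtain ⟨v, hv⟩ := exists_ne (0 : V)
    exact ⟨0, 1, fun h => hv (DFunLike.congr_fun h v).symm⟩
  have hinj : Function.Injective (Module.toAddMonoidEnd 𝒜 V) := RingHom.injective _
  apply hX
  apply hinj
  ext v
  rw [map_zero]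
  exact h v

end Idempotents

section Module

variable {K 𝒜 V : Type*} [Field K] [Ring 𝒜] [Algebra K 𝒜] {d : ℕ}
  (Φ : LeonardSystem K 𝒜 d) (e : 𝒜 ≃ₐ[K] Matrix (Fin (d + 1)) (Fin (d + 1)) K)
  [AddCommGroup V] [Module K V] [Module 𝒜 V] [IsScalarTower K 𝒜 V]

include e in
theorem exists_E_smul_eq_self [IsSimpleModule 𝒜 V] (i : Fin (d + 1)) :
    ∃ v : V, v ≠ 0 ∧ Φ.E i • v = v := by
  obtain ⟨v, hv⟩ := exists_smul_ne_zero (V := V) e (Φ.E_ne_zero e i)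
  exact ⟨Φ.E i • v, hv, by rw [smul_smul, Φ.E_mul_self e]⟩

theorem E_smul_smul {i : Fin (d + 1)} {v : V} (hv : Φ.E i • v = v) (X : 𝒜) :
    Φ.E i • X • v = (e (X * Φ.E i)).trace • v := by
  conv_lhs => rw [← hv]
  rw [smul_smul, smul_smul, Φ.E_mul_mul_E e, smul_assoc, hv]

include e in
-- Simplicity gives $x=Xv$, and then $x=E_iXE_iv$ is a trace times $v$. Thus each $E_iV$ is a line.
theorem exists_eq_smul_of_E_smul [IsSimpleModule 𝒜 V] {i : Fin (d + 1)} {v : V} (hv0 : v ≠ 0)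
    (hv : Φ.E i • v = v) {x : V} (hx : Φ.E i • x = x) : ∃ c : K, x = c • v := by
  obtain ⟨X, rfl⟩ := IsSimpleModule.toSpanSingleton_surjective 𝒜 hv0 x
  simp only [LinearMap.toSpanSingleton_apply] at hx ⊢
  exact ⟨_, by rw [← Φ.E_smul_smul e hv, hx]⟩

include e in
theorem E_smul_smul_ne_zero [IsSimpleModule 𝒜 V] {i : Fin (d + 1)} {v : V} (hv0 : v ≠ 0)
    (hv : Φ.E i • v = v) {X : 𝒜} (hX : X * Φ.E i ≠ 0) : X • v ≠ 0 := by
  intro h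
  obtain ⟨w, hw⟩ := exists_smul_ne_zero (V := V) e hX
  obtain ⟨c, hc⟩ := Φ.exists_eq_smul_of_E_smul e hv0 hv (x := Φ.E i • w)
    (by rw [smul_smul, Φ.E_mul_self e])
  apply hw
  rw [mul_smul, hc, smul_comm, h, smul_zero]

end Module

end LeonardSystem

/-! ### The polynomials $\tau_i$ and the cyclic vector in $E^*_0V$. -/

namespace LeonardSystem

section Polynomials

variable {K 𝒜 : Type*} [Field K] [Ring 𝒜] [Algebra K 𝒜] {d : ℕ} {Φ : LeonardSystem K 𝒜 d}

theorem monic_τ (i : ℕ) : (Φ.τ i).Monic := Polynomial.monic_prod_X_sub_C _ _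

theorem natDegree_τ (i : ℕ) : (Φ.τ i).natDegree = i := by
  rw [τ, Polynomial.natDegree_finsetProd_X_sub_C_eq_card, Finset.card_range]

theorem ofNat_val (j : Fin (d + 1)) : Fin.ofNat (d + 1) j = j :=
  Fin.ext (Nat.mod_eq_of_lt j.2)

theorem val_ofNat {i : ℕ} (hi : i ≤ d) : (Fin.ofNat (d + 1) i : ℕ) = i :=
  Nat.mod_eq_of_lt (by omega)

theorem eval_τ_eq_zero {i : ℕ} {j : Fin (d + 1)} (h : j < i) : (Φ.τ i).eval (Φ.θ j) = 0 := by
  rw [τ, Polynomial.eval_prod]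
  exact Finset.prod_eq_zero (Finset.mem_range.2 h) (by simp)

theorem eval_τ_ne_zero {i : ℕ} {j : Fin (d + 1)} (h : i ≤ j) : (Φ.τ i).eval (Φ.θ j) ≠ 0 := by
  rw [τ, Polynomial.eval_prod, Finset.prod_ne_zero_iff]
  intro k hk hk0
  rw [Finset.mem_range] at hk
  simp only [Polynomial.eval_sub, Polynomial.eval_X, Polynomial.eval_C, sub_eq_zero] at hk0
  have := congrArg Fin.val (Φ.eigenvalues.1 hk0)
  rw [val_ofNat (by omega)] at this
  omega

theorem τ_dvd {i : ℕ} (hi : i ≤ d + 1) {p : K[X]}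
    (h : ∀ j : Fin (d + 1), j < i → p.eval (Φ.θ j) = 0) : Φ.τ i ∣ p := by
  refine Finset.prod_dvd_of_coprime ?_ ?_
  · intro a ha b hb hab
    refine Polynomial.isCoprime_X_sub_C_of_isUnit_sub ?_
    rw [isUnit_iff_ne_zero, sub_ne_zero]
    intro hh
    simp only [Finset.coe_range, Set.mem_Iio] at ha hb
    have := congrArg Fin.val (Φ.eigenvalues.1 hh)
    rw [val_ofNat (by omega), val_ofNat (by omega)] at this
    exact hab this
  · intro a ha
    rw [Finset.mem_range] at ha
    rw [Polynomial.dvd_iff_isRoot]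
    exact h _ (by rw [val_ofNat (by omega)]; exact ha)

end Polynomials

section Cyclic

variable {K 𝒜 V : Type*} [Field K] [Ring 𝒜] [Algebra K 𝒜] {d : ℕ}
  (Φ : LeonardSystem K 𝒜 d) (e : 𝒜 ≃ₐ[K] Matrix (Fin (d + 1)) (Fin (d + 1)) K)
  [AddCommGroup V] [Module K V] [Module 𝒜 V] [IsScalarTower K 𝒜 V]

theorem E_smul_As_smul_E_smul_eq_zero {i j : Fin (d + 1)} (h : (i : ℕ) + 1 < j ∨ (j : ℕ) + 1 < i)
    (x : V) : Φ.E i • Φ.As • Φ.E j • x = 0 := by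
  rw [smul_smul, smul_smul, Φ.E_As_E_eq_zero, zero_smul]
  rw [lt_abs]
  omega

include e in
theorem E_smul_As_smul_E_smul_ne_zero [IsSimpleModule 𝒜 V] {i j : Fin (d + 1)}
    (h : (i : ℕ) + 1 = j ∨ (j : ℕ) + 1 = i) {x : V} (hx : Φ.E j • x ≠ 0) :
    Φ.E i • Φ.As • Φ.E j • x ≠ 0 := by
  rw [smul_smul]
  refine Φ.E_smul_smul_ne_zero e hx (by rw [smul_smul, Φ.E_mul_self e])
    (Φ.E_As_E_ne_zero i j ?_)
  rcases h with h | h <;> rw [← h] <;> simp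

include e

theorem E_smul_E_smul_of_ne {i j : Fin (d + 1)} (h : i ≠ j) (x : V) : Φ.E i • Φ.E j • x = 0 := by
  rw [smul_smul, Φ.E_mul_E_of_ne e h, zero_smul]

theorem E_smul_As_smul_eq_sum (i : Fin (d + 1)) (x : V) :
    Φ.E i • Φ.As • x = ∑ j, Φ.E i • Φ.As • Φ.E j • x := by
  conv_lhs => rw [← Φ.sum_E_smul e x]
  simp only [Finset.smul_sum]

theorem E_smul_eq_zero_of_E_smul_eq_self {i j : Fin (d + 1)} (h : i ≠ j) {x : V}
    (hx : Φ.E j • x = x) : Φ.E i • x = 0 := by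
  rw [← hx, Φ.E_smul_E_smul_of_ne e h]

theorem E_smul_As_smul_eq_zero_of_lt {k : ℕ} {x : V} (h : ∀ j : Fin (d + 1), k < j → Φ.E j • x = 0)
    {i : Fin (d + 1)} (hi : k + 1 < i) : Φ.E i • Φ.As • x = 0 := by
  rw [Φ.E_smul_As_smul_eq_sum e]
  refine Finset.sum_eq_zero fun j _ => ?_
  by_cases hj : k < j
  · rw [h j hj, smul_zero, smul_zero]
  · exact Φ.E_smul_As_smul_E_smul_eq_zero (by omega) x

theorem E_smul_As_smul_eq_zero_of_gt {k : ℕ} {x : V} (h : ∀ j : Fin (d + 1), j < k → Φ.E j • x = 0)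
    {i : Fin (d + 1)} (hi : i + 1 < k) : Φ.E i • Φ.As • x = 0 := by
  rw [Φ.E_smul_As_smul_eq_sum e]
  refine Finset.sum_eq_zero fun j _ => ?_
  by_cases hj : j < k
  · rw [h j hj, smul_zero, smul_zero]
  · exact Φ.E_smul_As_smul_E_smul_eq_zero (by omega) x

/-- $A^*$ shifts the index by at most one, so only the topmost component of $x$ can reach index
$k+1$. -/
theorem E_smul_As_smul_of_eq_succ {k : ℕ} {x : V} (h : ∀ j : Fin (d + 1), k < j → Φ.E j • x = 0)
    {i j : Fin (d + 1)} (hi : (i : ℕ) = k + 1) (hj : (j : ℕ) = k) :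
    Φ.E i • Φ.As • x = Φ.E i • Φ.As • Φ.E j • x := by
  rw [Φ.E_smul_As_smul_eq_sum e]
  refine Finset.sum_eq_single_of_mem j (Finset.mem_univ _) fun l _ hl => ?_
  by_cases hlk : k < l
  · rw [h l hlk, smul_zero, smul_zero]
  · have : (l : ℕ) ≠ j := fun hh => hl (Fin.ext hh)
    exact Φ.E_smul_As_smul_E_smul_eq_zero (by omega) x

theorem E_smul_As_smul_of_succ_eq {k : ℕ} {x : V} (h : ∀ j : Fin (d + 1), j < k → Φ.E j • x = 0)
    {i j : Fin (d + 1)} (hi : (i : ℕ) + 1 = k) (hj : (j : ℕ) = k) :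
    Φ.E i • Φ.As • x = Φ.E i • Φ.As • Φ.E j • x := by
  rw [Φ.E_smul_As_smul_eq_sum e]
  refine Finset.sum_eq_single_of_mem j (Finset.mem_univ _) fun l _ hl => ?_
  by_cases hlk : l < k
  · rw [h l hlk, smul_zero, smul_zero]
  · have : (l : ℕ) ≠ j := fun hh => hl (Fin.ext hh)
    exact Φ.E_smul_As_smul_E_smul_eq_zero (by omega) x

theorem E_smul_A_smul (i : Fin (d + 1)) (x : V) : Φ.E i • Φ.A • x = Φ.θ i • Φ.E i • x := by
  rw [smul_smul, Φ.E_mul_A e, smul_assoc]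

theorem E_smul_aeval_smul (i : Fin (d + 1)) (p : K[X]) (x : V) :
    Φ.E i • Polynomial.aeval Φ.A p • x = p.eval (Φ.θ i) • Φ.E i • x := by
  induction p using Polynomial.induction_on' with
  | add p q hp hq => rw [map_add, add_smul, smul_add, hp, hq, Polynomial.eval_add, add_smul]
  | monomial n c =>
    rw [Polynomial.aeval_monomial, Polynomial.eval_monomial, ← Algebra.smul_def, smul_assoc,
      smul_comm, mul_smul]
    congr 1
    induction n with
    | zero => simp
    | succ n ih => rw [pow_succ', mul_smul, Φ.E_smul_A_smul e, ih, pow_succ', mul_smul]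

variable {Φ} {v : V}

theorem Es_smul_pow_smul_eq_zero (hv : Φ.Es 0 • v = v) (n : ℕ) :
    ∀ k : Fin (d + 1), n < k → Φ.Es k • Φ.A ^ n • v = 0 := by
  induction n with
  | zero =>
    intro k hk
    rw [pow_zero, one_smul]
    exact Φ.dual.E_smul_eq_zero_of_E_smul_eq_self e (fun h => by simp [h] at hk) hv
  | succ n ih =>
    intro k hk
    rw [pow_succ', mul_smul]
    exact Φ.dual.E_smul_As_smul_eq_zero_of_lt e ih hk

/-- Each application of $A$ raises the top $E^*$-index by exactly one, since the adjacent blocks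
$E^*_{n+1}AE^*_n$ are nonzero. The degree of a polynomial $p$ can therefore be read off from the
$E^*$-components of $p(A)v$. -/
theorem Es_smul_pow_smul_ne_zero [IsSimpleModule 𝒜 V] (hv0 : v ≠ 0) (hv : Φ.Es 0 • v = v) (n : ℕ) :
    ∀ k : Fin (d + 1), (k : ℕ) = n → Φ.Es k • Φ.A ^ n • v ≠ 0 := by
  induction n with
  | zero =>
    intro k hk
    have : k = 0 := Fin.ext hk
    rwa [pow_zero, one_smul, this, hv]
  | succ n ih =>
    intro k hk
    have hn : n < d + 1 := by omega
    rw [pow_succ', mul_smul]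
    have h1 := Φ.dual.E_smul_As_smul_of_eq_succ e (Es_smul_pow_smul_eq_zero e hv n)
      (i := k) (j := ⟨n, hn⟩) hk rfl
    refine fun h => Φ.dual.E_smul_As_smul_E_smul_ne_zero e (i := k) (j := ⟨n, hn⟩)
      (by simp; omega) (ih ⟨n, hn⟩ rfl) (h1.symm.trans h)

theorem Es_smul_aeval_smul_eq_zero (hv : Φ.Es 0 • v = v) {p : K[X]} {k : Fin (d + 1)}
    (hk : p.natDegree < k) : Φ.Es k • Polynomial.aeval Φ.A p • v = 0 := by
  rw [Polynomial.aeval_eq_sum_range, Finset.sum_smul, Finset.smul_sum]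
  refine Finset.sum_eq_zero fun n hn => ?_
  rw [Finset.mem_range] at hn
  rw [smul_assoc, smul_comm, Es_smul_pow_smul_eq_zero e hv n k (by omega), smul_zero]

theorem Es_smul_aeval_smul_ne_zero [IsSimpleModule 𝒜 V] (hv0 : v ≠ 0) (hv : Φ.Es 0 • v = v)
    {p : K[X]} (hp : p ≠ 0) {k : Fin (d + 1)} (hk : (k : ℕ) = p.natDegree) :
    Φ.Es k • Polynomial.aeval Φ.A p • v ≠ 0 := by
  rw [Polynomial.aeval_eq_sum_range, Finset.sum_smul, Finset.smul_sum, Finset.sum_range_succ,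
    Finset.sum_eq_zero, zero_add, smul_assoc, smul_comm]
  · exact smul_ne_zero (by simpa using hp) (Es_smul_pow_smul_ne_zero e hv0 hv _ k hk)
  · intro n hn
    rw [Finset.mem_range] at hn
    rw [smul_assoc, smul_comm, Es_smul_pow_smul_eq_zero e hv n k (by omega), smul_zero]

/-- If $E_rv=0$, the degree-$d$ polynomial vanishing at all eigenvalues except $\theta_r$ would
annihilate $v$. Its leading term, however, gives a nonzero $E^*_d$-component. -/
theorem E_smul_ne_zero [IsSimpleModule 𝒜 V] (hv0 : v ≠ 0) (hv : Φ.Es 0 • v = v)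
    (r : Fin (d + 1)) : Φ.E r • v ≠ 0 := by
  intro hr
  let p : K[X] := ∏ j ∈ Finset.univ.erase r, (Polynomial.X - Polynomial.C (Φ.θ j))
  have hp : p.natDegree = d := by
    rw [Polynomial.natDegree_finsetProd_X_sub_C_eq_card]
    simp
  have hp0 : p ≠ 0 := (Polynomial.monic_prod_X_sub_C _ _).ne_zero
  apply Es_smul_aeval_smul_ne_zero e hv0 hv hp0 (k := Fin.last d) (by simp [hp])
  rw [← Φ.sum_E_smul e (Polynomial.aeval Φ.A p • v), Finset.sum_eq_zero, smul_zero]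
  intro j _
  rw [Φ.E_smul_aeval_smul e]
  by_cases hj : j = r
  · rw [hj, hr, smul_zero]
  · rw [Polynomial.eval_prod, Finset.prod_eq_zero (i := j) (by simp [hj]) (by simp), zero_smul]

theorem exists_eq_aeval_smul [IsSimpleModule 𝒜 V] (hv0 : v ≠ 0) (hv : Φ.Es 0 • v = v) (x : V) :
    ∃ p : K[X], p.degree < (d + 1 : ℕ) ∧ x = Polynomial.aeval Φ.A p • v := by
  have h : ∀ r, ∃ c : K, Φ.E r • x = c • Φ.E r • v := fun r =>
    Φ.exists_eq_smul_of_E_smul e (E_smul_ne_zero e hv0 hv r)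
      (by rw [smul_smul, Φ.E_mul_self e]) (by rw [smul_smul, Φ.E_mul_self e])
  choose c hc using h
  refine ⟨Lagrange.interpolate Finset.univ Φ.θ c, ?_, ?_⟩
  · simpa using Lagrange.degree_interpolate_lt c (Φ.eigenvalues.1.injOn (s := (Finset.univ : Finset (Fin (d + 1)))))
  · rw [← Φ.sum_E_smul e x,
      ← Φ.sum_E_smul e (Polynomial.aeval Φ.A (Lagrange.interpolate Finset.univ Φ.θ c) • v)]
    refine Finset.sum_congr rfl fun r _ => ?_
    rw [Φ.E_smul_aeval_smul e, Lagrange.eval_interpolate_at_node c Φ.eigenvalues.1.injOn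
      (Finset.mem_univ r), hc]

/-- The `i`-th component of the split decomposition is spanned by `τ_i(A) v`. -/
theorem exists_eq_smul_aeval_τ_smul [IsSimpleModule 𝒜 V] (hv0 : v ≠ 0) (hv : Φ.Es 0 • v = v)
    {i : ℕ} (hi : i ≤ d) {x : V} (h1 : ∀ j : Fin (d + 1), i < j → Φ.Es j • x = 0)
    (h2 : ∀ j : Fin (d + 1), j < i → Φ.E j • x = 0) :
    ∃ c : K, x = c • Polynomial.aeval Φ.A (Φ.τ i) • v := by
  obtain ⟨p, hp, rfl⟩ := exists_eq_aeval_smul e hv0 hv x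
  -- The vanishing $E_j$-components force $\theta_0,\dots,\theta_{i-1}$ to be roots of $p$, and the
  -- vanishing $E^*_j$-components bound its degree by $i$. Only a constant cofactor survives.
  obtain ⟨q, rfl⟩ : Φ.τ i ∣ p := by
    refine τ_dvd (by omega) fun j hj => ?_
    have := h2 j hj
    rw [Φ.E_smul_aeval_smul e] at this
    exact (smul_eq_zero.1 this).resolve_right (E_smul_ne_zero e hv0 hv j)
  by_cases hq : q = 0
  · exact ⟨0, by simp [hq]⟩
  have hpq : Φ.τ i * q ≠ 0 := mul_ne_zero (monic_τ i).ne_zero hq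
  have hdeg : (Φ.τ i * q).natDegree ≤ i := by
    by_contra! hlt
    rw [Polynomial.degree_eq_natDegree hpq, Nat.cast_lt] at hp
    exact Es_smul_aeval_smul_ne_zero e hv0 hv hpq (k := ⟨_, hp⟩) rfl (h1 _ hlt)
  rw [Polynomial.natDegree_mul (monic_τ i).ne_zero hq, natDegree_τ] at hdeg
  obtain ⟨c, rfl⟩ := Polynomial.natDegree_eq_zero.1 (show q.natDegree = 0 by omega)
  exact ⟨c, by rw [mul_comm, ← Polynomial.smul_eq_C_mul, map_smul, smul_assoc]⟩

end Cyclic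

end LeonardSystem

/-! ### The split basis and the first split sequence. -/

namespace LeonardSystem

/-- The vector `τ_i(A) v`. -/
def splitVector {K 𝒜 V : Type*} [Field K] [Ring 𝒜] [Algebra K 𝒜] {d : ℕ}
    [AddCommGroup V] [Module 𝒜 V] (Φ : LeonardSystem K 𝒜 d) (v : V) (i : ℕ) : V :=
  Polynomial.aeval Φ.A (Φ.τ i) • v

section Split

variable {K 𝒜 V : Type*} [Field K] [Ring 𝒜] [Algebra K 𝒜] {d : ℕ}
  {Φ : LeonardSystem K 𝒜 d} (e : 𝒜 ≃ₐ[K] Matrix (Fin (d + 1)) (Fin (d + 1)) K)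
  [AddCommGroup V] [Module K V] [Module 𝒜 V] [IsScalarTower K 𝒜 V] {v : V}

/-- Here and at index $d+1$, where `Fin.ofNat` wraps to $0$, the factor $\theta^*_0-\theta^*_i$
vanishes. These default values let the boundary cases share the formulas of the interior ones. -/
theorem firstSplit_zero : Φ.firstSplit e 0 = 0 := by
  simp [firstSplit]

theorem firstSplit_succ_d : Φ.firstSplit e (d + 1) = 0 := by
  have : Fin.ofNat (d + 1) (d + 1) = 0 := Fin.ext (by simp)
  rw [firstSplit, this, sub_self, zero_mul]

theorem splitVector_zero : Φ.splitVector v 0 = v := by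
  simp [splitVector, τ]

theorem A_smul_splitVector (i : ℕ) : Φ.A • Φ.splitVector v i =
    Φ.θ (Fin.ofNat (d + 1) i) • Φ.splitVector v i + Φ.splitVector v (i + 1) := by
  have h : Φ.τ (i + 1) = (Polynomial.X - Polynomial.C (Φ.θ (Fin.ofNat (d + 1) i))) * Φ.τ i := by
    rw [τ, Finset.prod_range_succ, mul_comm, τ]
  simp only [splitVector, h, map_mul, map_sub, Polynomial.aeval_X, Polynomial.aeval_C, mul_smul,
    sub_smul, algebraMap_smul]
  abel

include e

theorem Es_smul_splitVector_eq_zero (hv : Φ.Es 0 • v = v) {i : ℕ} {k : Fin (d + 1)} (hk : i < k) :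
    Φ.Es k • Φ.splitVector v i = 0 :=
  Es_smul_aeval_smul_eq_zero e hv (by rwa [natDegree_τ])

theorem E_smul_splitVector_eq_zero {i : ℕ} {k : Fin (d + 1)} (hk : k < i) :
    Φ.E k • Φ.splitVector v i = 0 := by
  rw [splitVector, Φ.E_smul_aeval_smul e, eval_τ_eq_zero hk, zero_smul]

theorem splitVector_succ_d : Φ.splitVector v (d + 1) = 0 := by
  rw [← Φ.sum_E_smul e (Φ.splitVector v (d + 1))]
  exact Finset.sum_eq_zero fun j _ => E_smul_splitVector_eq_zero e j.2

variable [IsSimpleModule 𝒜 V]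

theorem Es_smul_splitVector_ne_zero (hv0 : v ≠ 0) (hv : Φ.Es 0 • v = v) {i : ℕ} {k : Fin (d + 1)}
    (hk : (k : ℕ) = i) : Φ.Es k • Φ.splitVector v i ≠ 0 :=
  Es_smul_aeval_smul_ne_zero e hv0 hv (monic_τ i).ne_zero (by rwa [natDegree_τ])

theorem E_smul_splitVector_ne_zero (hv0 : v ≠ 0) (hv : Φ.Es 0 • v = v) {i : ℕ} {k : Fin (d + 1)}
    (hk : i ≤ k) : Φ.E k • Φ.splitVector v i ≠ 0 := by
  rw [splitVector, Φ.E_smul_aeval_smul e]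
  exact smul_ne_zero (eval_τ_ne_zero hk) (E_smul_ne_zero e hv0 hv k)

theorem splitVector_ne_zero (hv0 : v ≠ 0) (hv : Φ.Es 0 • v = v) {i : ℕ} (hi : i ≤ d) :
    Φ.splitVector v i ≠ 0 := fun h =>
  Es_smul_splitVector_ne_zero e hv0 hv (k := ⟨i, by omega⟩) rfl (by rw [h, smul_zero])

/-- Subtracting $\theta^*_{i+1}$ removes the top $E^*$-component, while $A^*$ lowers the least
$E$-index by at most one, so the difference lies on the $i$-th split line. The coefficient is
nonzero because the $E_i$-component comes from the nonzero block $E_iA^*E_{i+1}$. -/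
theorem exists_As_smul_splitVector (hv0 : v ≠ 0) (hv : Φ.Es 0 • v = v) {i : ℕ} (hi : i + 1 ≤ d) :
    ∃ c : K, c ≠ 0 ∧ Φ.As • Φ.splitVector v (i + 1) =
      Φ.θs (Fin.ofNat (d + 1) (i + 1)) • Φ.splitVector v (i + 1) + c • Φ.splitVector v i := by
  set w := Φ.As • Φ.splitVector v (i + 1) -
      Φ.θs (Fin.ofNat (d + 1) (i + 1)) • Φ.splitVector v (i + 1) with hw
  have hE : ∀ j : Fin (d + 1), (j : ℕ) ≤ i → Φ.E j • w = Φ.E j • Φ.As • Φ.splitVector v (i + 1) := by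
    intro j hj
    rw [hw, smul_sub, smul_comm (Φ.E j) (Φ.θs _), E_smul_splitVector_eq_zero e (by omega),
      smul_zero, sub_zero]
  obtain ⟨c, hc⟩ := exists_eq_smul_aeval_τ_smul e hv0 hv (i := i) (by omega) (x := w)
    (by
      intro j hj
      have h1 : Φ.Es j • Φ.As • Φ.splitVector v (i + 1) = Φ.θs j • Φ.Es j • Φ.splitVector v (i + 1) :=
        Φ.dual.E_smul_A_smul e j _
      rw [hw, smul_sub, h1, smul_comm (Φ.Es j) (Φ.θs _)]
      by_cases hj' : (j : ℕ) = i + 1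
      · rw [← hj', ofNat_val, sub_self]
      · rw [Es_smul_splitVector_eq_zero e hv (by omega), smul_zero, smul_zero, sub_zero])
    (by
      intro j hj
      rw [hE j hj.le]
      exact Φ.E_smul_As_smul_eq_zero_of_gt e (k := i + 1)
        (fun l hl => E_smul_splitVector_eq_zero e hl) (by omega))
  change w = c • Φ.splitVector v i at hc
  refine ⟨c, ?_, by rw [← hc, hw]; abel⟩
  rintro rfl
  rw [zero_smul] at hc
  have h1 := hE ⟨i, by omega⟩ le_rfl
  rw [hc, smul_zero, Φ.E_smul_As_smul_of_succ_eq e (k := i + 1) (j := ⟨i + 1, by omega⟩)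
    (fun l hl => E_smul_splitVector_eq_zero e hl) rfl rfl] at h1
  exact Φ.E_smul_As_smul_E_smul_ne_zero e (by simp)
    (E_smul_splitVector_ne_zero e hv0 hv le_rfl) h1.symm

/-- The trace `tr(τ_i(A) E*_0)` is the coefficient of `v` in the `E*_0`-component of `τ_i(A) v`. -/
theorem Es_zero_smul_splitVector (hv : Φ.Es 0 • v = v) (i : ℕ) : Φ.Es 0 • Φ.splitVector v i =
    (e (Polynomial.aeval Φ.A (Φ.τ i) * Φ.Es 0)).trace • v :=
  Φ.dual.E_smul_smul e hv _

/-- Take $E^*_0$-components in the lowering relation. The result identifies `c` with the split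
parameter and, as `c` is nonzero, shows inductively that no denominator in the definition of
$\varphi_i$ vanishes. -/
theorem trace_recurrence (hv0 : v ≠ 0) (hv : Φ.Es 0 • v = v) {i : ℕ} {c : K}
    (hc : Φ.As • Φ.splitVector v (i + 1) =
      Φ.θs (Fin.ofNat (d + 1) (i + 1)) • Φ.splitVector v (i + 1) + c • Φ.splitVector v i) :
    (Φ.θs 0 - Φ.θs (Fin.ofNat (d + 1) (i + 1))) *
      (e (Polynomial.aeval Φ.A (Φ.τ (i + 1)) * Φ.Es 0)).trace =
    c * (e (Polynomial.aeval Φ.A (Φ.τ i) * Φ.Es 0)).trace := by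
  have h1 : Φ.Es 0 • Φ.As • Φ.splitVector v (i + 1) = Φ.θs 0 • Φ.Es 0 • Φ.splitVector v (i + 1) :=
    Φ.dual.E_smul_A_smul e 0 _
  rw [hc, smul_add, smul_comm (Φ.Es 0), smul_comm (Φ.Es 0), Es_zero_smul_splitVector e hv,
    Es_zero_smul_splitVector e hv, ← sub_eq_zero, smul_smul, smul_smul, smul_smul, ← add_smul,
    ← sub_smul, smul_eq_zero] at h1
  linear_combination -(h1.resolve_right hv0)

theorem trace_ne_zero (hv0 : v ≠ 0) (hv : Φ.Es 0 • v = v) {i : ℕ} (hi : i ≤ d) :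
    (e (Polynomial.aeval Φ.A (Φ.τ i) * Φ.Es 0)).trace ≠ 0 := by
  induction i with
  | zero =>
    have := Es_zero_smul_splitVector e hv 0
    rw [splitVector_zero, hv] at this
    intro h
    rw [h, zero_smul] at this
    exact hv0 this
  | succ i ih =>
    obtain ⟨c, hc0, hc⟩ := exists_As_smul_splitVector e hv0 hv hi
    intro h
    have := trace_recurrence e hv0 hv hc
    rw [h, mul_zero] at this
    exact mul_ne_zero hc0 (ih (by omega)) this.symm

theorem firstSplit_spec (hv0 : v ≠ 0) (hv : Φ.Es 0 • v = v) {i : ℕ} (hi : i + 1 ≤ d) :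
    Φ.firstSplit e (i + 1) ≠ 0 ∧ Φ.As • Φ.splitVector v (i + 1) =
      Φ.θs (Fin.ofNat (d + 1) (i + 1)) • Φ.splitVector v (i + 1) +
        Φ.firstSplit e (i + 1) • Φ.splitVector v i := by
  obtain ⟨c, hc0, hc⟩ := exists_As_smul_splitVector e hv0 hv hi
  have h : Φ.firstSplit e (i + 1) = c := by
    rw [firstSplit, Nat.add_sub_cancel, ← mul_div_assoc, trace_recurrence e hv0 hv hc,
      mul_div_cancel_right₀ _ (trace_ne_zero e hv0 hv (by omega))]
  rw [h]
  exact ⟨hc0, hc⟩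

theorem Es_smul_splitVector_succ (hv0 : v ≠ 0) (hv : Φ.Es 0 • v = v) {i : ℕ} (hi : i ≤ d) :
    Φ.Es (Fin.ofNat (d + 1) i) • Φ.splitVector v (i + 1) =
      (Φ.firstSplit e (i + 1) /
        (Φ.θs (Fin.ofNat (d + 1) i) - Φ.θs (Fin.ofNat (d + 1) (i + 1)))) •
        Φ.Es (Fin.ofNat (d + 1) i) • Φ.splitVector v i := by
  rcases hi.eq_or_lt with rfl | hi
  · rw [splitVector_succ_d e, firstSplit_succ_d, zero_div, zero_smul, smul_zero]
  · have hne : Φ.θs (Fin.ofNat (d + 1) i) - Φ.θs (Fin.ofNat (d + 1) (i + 1)) ≠ 0 := by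
      rw [sub_ne_zero]
      intro h
      have := congrArg Fin.val (Φ.dual_eigenvalues.1 h)
      rw [val_ofNat hi.le, val_ofNat hi] at this
      omega
    have h1 : Φ.Es (Fin.ofNat (d + 1) i) • Φ.As • Φ.splitVector v (i + 1) =
        Φ.θs _ • Φ.Es _ • Φ.splitVector v (i + 1) := Φ.dual.E_smul_A_smul e _ _
    rw [(firstSplit_spec e hv0 hv hi).2, smul_add, smul_comm _ (Φ.θs _),
      smul_comm _ (Φ.firstSplit e _)] at h1
    rw [div_eq_inv_mul, mul_smul, eq_inv_smul_iff₀ hne, sub_smul, ← h1]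
    abel

/-- The diagonal entries `tr(A E*_i)` in terms of the first split sequence. -/
theorem trace_A_mul_Es (hv0 : v ≠ 0) (hv : Φ.Es 0 • v = v) {i : ℕ} (hi : i ≤ d) :
    (e (Φ.A * Φ.Es (Fin.ofNat (d + 1) i))).trace = Φ.θ (Fin.ofNat (d + 1) i) +
      Φ.firstSplit e i / (Φ.θs (Fin.ofNat (d + 1) i) - Φ.θs (Fin.ofNat (d + 1) (i - 1))) +
      Φ.firstSplit e (i + 1) /
        (Φ.θs (Fin.ofNat (d + 1) i) - Φ.θs (Fin.ofNat (d + 1) (i + 1))) := by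
  set k := Fin.ofNat (d + 1) i with hk
  have hki : (k : ℕ) = i := val_ofNat hi
  have hy0 := Es_smul_splitVector_ne_zero e hv0 hv hki
  set y := Φ.Es k • Φ.splitVector v i with hy
  have hyk : Φ.Es k • y = y := by
    rw [hy, smul_smul, show Φ.Es k * Φ.Es k = Φ.Es k from Φ.dual.E_mul_self e k]
  have htr : Φ.Es k • Φ.A • y = (e (Φ.A * Φ.Es k)).trace • y := Φ.dual.E_smul_smul e hyk _
  have hA : Φ.Es k • Φ.A • Φ.splitVector v i = Φ.θ k • y + (Φ.firstSplit e (i + 1) /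
        (Φ.θs k - Φ.θs (Fin.ofNat (d + 1) (i + 1)))) • y := by
    rw [A_smul_splitVector, smul_add, smul_comm (Φ.Es k), hk,
      Es_smul_splitVector_succ e hv0 hv hi]
  cases i with
  | zero =>
    have hk0 : k = 0 := Fin.ext hki
    rw [splitVector_zero, hk0] at hy
    rw [splitVector_zero, ← hv, ← hy, htr, ← add_smul] at hA
    rw [firstSplit_zero, zero_div, add_zero]
    exact smul_left_injective K hy0 hA
  | succ n =>
    have hn : (Fin.ofNat (d + 1) n : ℕ) = n := val_ofNat (by omega)
    -- Removing the top component `y` leaves a vector supported on $E^*$-indices at most $n$, of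
    -- which only index $n$ reaches $k=n+1$ under $A$.
    have h1 : Φ.Es k • Φ.A • (Φ.splitVector v (n + 1) - y) =
        Φ.Es k • Φ.A • Φ.Es (Fin.ofNat (d + 1) n) • (Φ.splitVector v (n + 1) - y) := by
      refine Φ.dual.E_smul_As_smul_of_eq_succ e (k := n) (fun j hj => ?_) hki hn
      change Φ.Es j • _ = _
      rw [smul_sub]
      by_cases hjk : j = k
      · rw [hjk, hyk, ← hy, sub_self]
      · have h2 : (j : ℕ) ≠ k := fun h => hjk (Fin.ext h)
        rw [Es_smul_splitVector_eq_zero e hv (by omega),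
          show Φ.Es j • y = 0 from Φ.dual.E_smul_eq_zero_of_E_smul_eq_self e hjk hyk, sub_zero]
    have hnk : Fin.ofNat (d + 1) n ≠ k := fun h => by
      have := congrArg Fin.val h
      omega
    have h2 : Φ.Es k • Φ.A • Φ.Es (Fin.ofNat (d + 1) n) • Φ.splitVector v n = y := by
      have h3 : Φ.Es k • Φ.A • Φ.splitVector v n = _ :=
        Φ.dual.E_smul_As_smul_of_eq_succ e (k := n)
          (fun j hj => Es_smul_splitVector_eq_zero e hv hj) hki hn
      refine h3.symm.trans ?_
      rw [A_smul_splitVector, smul_add, smul_comm (Φ.Es k),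
        Es_smul_splitVector_eq_zero e hv (by omega), smul_zero, zero_add]
    have h4 : Φ.Es (Fin.ofNat (d + 1) n) • y = 0 :=
      Φ.dual.E_smul_eq_zero_of_E_smul_eq_self e hnk hyk
    rw [smul_sub (Φ.Es (Fin.ofNat (d + 1) n)), h4, sub_zero,
      Es_smul_splitVector_succ e hv0 hv (by omega), smul_comm Φ.A,
      smul_comm (Φ.Es k) (Φ.firstSplit e (n + 1) / _), h2,
      smul_sub, smul_sub, hA, htr, ← add_smul, ← sub_smul] at h1
    have h5 := smul_left_injective K hy0 h1
    rw [Nat.add_sub_cancel, ← neg_sub (Φ.θs (Fin.ofNat (d + 1) n)), div_neg, hk, ← hk]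
    linear_combination -h5

end Split

end LeonardSystem

/-! ### Reversed Leonard systems, the second split sequence and the switching element. -/

theorem IsEigenvalueOrdering.comp_rev {K 𝒜 : Type*} [Field K] [Ring 𝒜] [Algebra K 𝒜] {d : ℕ}
    {A : 𝒜} {θ : Fin (d + 1) → K} (h : IsEigenvalueOrdering A θ) :
    IsEigenvalueOrdering A (θ ∘ Fin.rev) :=
  ⟨h.1.comp Fin.rev_injective, by rw [Fin.rev_surjective.range_comp, h.2]⟩

theorem primitiveIdempotent_comp_rev {K 𝒜 : Type*} [Field K] [Ring 𝒜] [Algebra K 𝒜] {d : ℕ}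
    (A : 𝒜) (θ : Fin (d + 1) → K) (i : Fin (d + 1)) :
    primitiveIdempotent A (θ ∘ Fin.rev) i = primitiveIdempotent A θ i.rev := by
  unfold primitiveIdempotent
  congr 1
  refine Finset.prod_equiv Fin.revPerm (fun j => ?_) (fun j _ => ?_)
  · simp [Fin.rev_inj]
  · simp

namespace LeonardSystem

/-- The Leonard system `(A; {E_{d-i}}; A*; {E*_i})`. -/
def reverseE {K 𝒜 : Type*} [Field K] [Ring 𝒜] [Algebra K 𝒜] {d : ℕ}
    (Φ : LeonardSystem K 𝒜 d) : LeonardSystem K 𝒜 d where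
  A := Φ.A
  E := Φ.E ∘ Fin.rev
  As := Φ.As
  Es := Φ.Es
  θ := Φ.θ ∘ Fin.rev
  θs := Φ.θs
  eigenvalues := Φ.eigenvalues.comp_rev
  dual_eigenvalues := Φ.dual_eigenvalues
  E_eq i := by rw [primitiveIdempotent_comp_rev, Function.comp_apply, Φ.E_eq]
  Es_eq := Φ.Es_eq
  E_As_E_eq_zero i j h := Φ.E_As_E_eq_zero _ _ (by
    rw [lt_abs] at h ⊢
    simp only [Fin.val_rev]
    omega)
  E_As_E_ne_zero i j h := Φ.E_As_E_ne_zero _ _ (by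
    rw [abs_eq (by norm_num)] at h ⊢
    simp only [Fin.val_rev]
    omega)
  Es_A_Es_eq_zero := Φ.Es_A_Es_eq_zero
  Es_A_Es_ne_zero := Φ.Es_A_Es_ne_zero

/-- The Leonard system `(A; {E_i}; A*; {E*_{d-i}})`. -/
def reverseEs {K 𝒜 : Type*} [Field K] [Ring 𝒜] [Algebra K 𝒜] {d : ℕ}
    (Φ : LeonardSystem K 𝒜 d) : LeonardSystem K 𝒜 d :=
  Φ.dual.reverseE.dual

theorem rev_ofNat {d i : ℕ} (hi : i ≤ d) : (Fin.ofNat (d + 1) i).rev = Fin.ofNat (d + 1) (d - i) := by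
  ext
  rw [Fin.val_rev, val_ofNat hi, val_ofNat (by omega)]
  omega

/-- The coefficient of `E_r` in the switching element. -/
def switchingCoeff {K 𝒜 : Type*} [Field K] [Ring 𝒜] [Algebra K 𝒜] {d : ℕ}
    (Φ : LeonardSystem K 𝒜 d) (e : 𝒜 ≃ₐ[K] Matrix (Fin (d + 1)) (Fin (d + 1)) K) (r : ℕ) : K :=
  (∏ h ∈ Finset.Icc (d - r + 1) d, Φ.secondSplit e h) / ∏ h ∈ Finset.Icc 1 r, Φ.firstSplit e h

section Parameters

variable {K 𝒜 V : Type*} [Field K] [Ring 𝒜] [Algebra K 𝒜] {d : ℕ}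
  {Φ : LeonardSystem K 𝒜 d} (e : 𝒜 ≃ₐ[K] Matrix (Fin (d + 1)) (Fin (d + 1)) K)

theorem η_eq {i : ℕ} (hi : i ≤ d + 1) : Φ.η i = Φ.reverseE.τ i := by
  refine Finset.prod_congr rfl fun h hh => ?_
  rw [Finset.mem_range] at hh
  change _ = Polynomial.X - Polynomial.C (Φ.θ (Fin.rev _))
  rw [rev_ofNat (by omega)]

theorem secondSplit_eq {i : ℕ} (hi : i ≤ d) : Φ.secondSplit e i = Φ.reverseE.firstSplit e i := by
  rw [secondSplit, firstSplit, η_eq (by omega), η_eq (by omega)]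
  rfl

theorem secondSplit_reverseE {i : ℕ} (hi : i ≤ d) :
    Φ.reverseE.secondSplit e i = Φ.firstSplit e i := by
  rw [secondSplit_eq e hi]
  have : Φ.reverseE.reverseE.τ = Φ.τ := by
    ext1 i
    exact Finset.prod_congr rfl fun h _ => by
      change Polynomial.X - Polynomial.C (Φ.θ (Fin.rev (Fin.rev _))) = _
      rw [Fin.rev_rev]
  rw [firstSplit, firstSplit, this]
  rfl

variable [AddCommGroup V] [Module K V] [Module 𝒜 V] [IsScalarTower K 𝒜 V] [IsSimpleModule 𝒜 V]
  {v w : V} (hv0 : v ≠ 0) (hv : Φ.Es 0 • v = v) (hw0 : w ≠ 0) (hw : Φ.Es (Fin.last d) • w = w)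

include hv0 hv hw0 hw

/-- The second split sequence of `Φ` is the reversal of the first split sequence of
`(A; {E_i}; A*; {E*_{d-i}})`. -/
theorem firstSplit_reverseE_eq {n : ℕ} (hn : n ≤ d + 1) :
    Φ.reverseE.firstSplit e n = Φ.reverseEs.firstSplit e (d + 1 - n) := by
  induction n with
  | zero => rw [firstSplit_zero, Nat.sub_zero, firstSplit_succ_d]
  | succ n ih =>
    specialize ih (by omega)
    rcases (show n ≤ d by omega).eq_or_lt with rfl | hnd
    · rw [firstSplit_succ_d, Nat.sub_self, firstSplit_zero]
    have hw' : Φ.reverseEs.Es 0 • w = w := by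
      change Φ.Es (Fin.rev 0) • w = w
      rwa [Fin.rev_zero]
    -- Both formulas compute $\mathrm{tr}(AE^*_n)$, with the same leading term $\theta_{d-n}$. The
    -- induction hypothesis cancels one fraction and leaves the equality sought.
    have h1 := trace_A_mul_Es (Φ := Φ.reverseE) e hv0 hv (i := n) (by omega)
    have h2 := trace_A_mul_Es (Φ := Φ.reverseEs) e hw0 hw' (i := d - n) (by omega)
    change (e (Φ.A * Φ.Es _)).trace = Φ.θ (Fin.rev _) + _ / (Φ.θs _ - Φ.θs _) +
      _ / (Φ.θs _ - Φ.θs _) at h1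
    change (e (Φ.A * Φ.Es (Fin.rev _))).trace = Φ.θ _ +
      _ / (Φ.θs (Fin.rev _) - Φ.θs (Fin.rev _)) + _ / (Φ.θs (Fin.rev _) - Φ.θs (Fin.rev _)) at h2
    rw [rev_ofNat (by omega)] at h1
    rw [rev_ofNat (i := d - n) (by omega), rev_ofNat (i := d - n - 1) (by omega),
      show d - (d - n) = n by omega, show d - (d - n - 1) = n + 1 by omega,
      show d - n + 1 = d + 1 - n by omega, ← ih] at h2
    have hne : Φ.θs (Fin.ofNat (d + 1) n) - Φ.θs (Fin.ofNat (d + 1) (n + 1)) ≠ 0 := by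
      rw [sub_ne_zero]
      intro h
      have := congrArg Fin.val (Φ.dual_eigenvalues.1 h)
      rw [val_ofNat hnd.le, val_ofNat hnd] at this
      omega
    -- For $n=0$ the neighbouring index is a default value, harmless because the numerator is zero.
    have h3 : Φ.reverseE.firstSplit e n / (Φ.θs (Fin.ofNat (d + 1) n) -
          Φ.θs (Fin.rev (Fin.ofNat (d + 1) (d + 1 - n)))) =
        Φ.reverseE.firstSplit e n / (Φ.θs (Fin.ofNat (d + 1) n) -
          Φ.θs (Fin.ofNat (d + 1) (n - 1))) := by
      cases n with
      | zero => rw [firstSplit_zero, zero_div, zero_div]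
      | succ n => rw [rev_ofNat (by omega), show d - (d + 1 - (n + 1)) = n + 1 - 1 by omega]
    rw [h3, h1] at h2
    rw [show d + 1 - (n + 1) = d - n by omega]
    refine (div_left_inj' hne).1 ?_
    linear_combination h2

theorem firstSplit_reverseEs {n : ℕ} (h1 : 1 ≤ n) (hn : n ≤ d) :
    Φ.reverseEs.firstSplit e n = Φ.secondSplit e (d + 1 - n) := by
  rw [secondSplit_eq e (by omega), firstSplit_reverseE_eq e hv0 hv hw0 hw (by omega)]
  congr 1
  omega

omit hw0 hw in
theorem firstSplit_ne_zero {n : ℕ} (h1 : 1 ≤ n) (hn : n ≤ d) : Φ.firstSplit e n ≠ 0 := by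
  obtain ⟨m, rfl⟩ : ∃ m, n = m + 1 := ⟨n - 1, by omega⟩
  exact (firstSplit_spec e hv0 hv hn).1

omit hw0 hw in
theorem secondSplit_ne_zero {n : ℕ} (h1 : 1 ≤ n) (hn : n ≤ d) : Φ.secondSplit e n ≠ 0 := by
  rw [secondSplit_eq e hn]
  exact firstSplit_ne_zero (Φ := Φ.reverseE) e hv0 hv h1 hn

omit hw0 hw in
-- Take the $E_n$-component of the lowering relation for $\tau_{n+1}(A)v$. Reversing the $E^*_i$
-- changes only the vector and the split parameter in this identity, so $E^*_0V$ and $E^*_dV$ can be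
-- compared.
theorem E_smul_As_smul_E_succ_smul {n : ℕ} (hn : n + 1 ≤ d) :
    (Φ.τ (n + 1)).eval (Φ.θ (Fin.ofNat (d + 1) (n + 1))) •
      Φ.E (Fin.ofNat (d + 1) n) • Φ.As • Φ.E (Fin.ofNat (d + 1) (n + 1)) • v =
    (Φ.firstSplit e (n + 1) * (Φ.τ n).eval (Φ.θ (Fin.ofNat (d + 1) n))) •
      Φ.E (Fin.ofNat (d + 1) n) • v := by
  have h1 : Φ.E (Fin.ofNat (d + 1) n) • Φ.As • Φ.splitVector v (n + 1) =
      Φ.E (Fin.ofNat (d + 1) n) • Φ.As • Φ.E (Fin.ofNat (d + 1) (n + 1)) •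
        Φ.splitVector v (n + 1) :=
    Φ.E_smul_As_smul_of_succ_eq e (k := n + 1) (fun l hl => E_smul_splitVector_eq_zero e hl)
      (by rw [val_ofNat (by omega)]) (by rw [val_ofNat (by omega)])
  rw [(firstSplit_spec e hv0 hv hn).2, smul_add, smul_comm (Φ.E _),
    E_smul_splitVector_eq_zero e (by rw [val_ofNat (by omega)]; omega), smul_zero, zero_add,
    splitVector, splitVector, Φ.E_smul_aeval_smul e, smul_comm (Φ.E _) (Φ.firstSplit e (n + 1)),
    Φ.E_smul_aeval_smul e, smul_comm Φ.As, smul_comm (Φ.E _) (Polynomial.eval _ _), smul_smul] at h1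
  exact h1.symm

omit hv0 hv hw0 hw in
theorem switchingCoeff_zero : Φ.switchingCoeff e 0 = 1 := by
  simp [switchingCoeff]

omit hw0 hw in
theorem switchingCoeff_succ {n : ℕ} (hn : n + 1 ≤ d) :
    Φ.switchingCoeff e (n + 1) * Φ.firstSplit e (n + 1) =
      Φ.secondSplit e (d - n) * Φ.switchingCoeff e n := by
  have h0 : Φ.firstSplit e (n + 1) ≠ 0 := firstSplit_ne_zero e hv0 hv (by omega) hn
  have h1 : Finset.Icc (d - (n + 1) + 1) d = insert (d - n) (Finset.Icc (d - n + 1) d) := by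
    ext
    simp only [Finset.mem_Icc, Finset.mem_insert]
    omega
  rw [switchingCoeff, switchingCoeff, Finset.prod_Icc_succ_top (by omega), h1,
    Finset.prod_insert (by simp)]
  field_simp

omit hw0 hw in
theorem switchingCoeff_ne_zero {r : ℕ} (hr : r ≤ d) : Φ.switchingCoeff e r ≠ 0 := by
  refine div_ne_zero (Finset.prod_ne_zero_iff.2 fun h hh => ?_)
    (Finset.prod_ne_zero_iff.2 fun h hh => ?_) <;> rw [Finset.mem_Icc] at hh
  · exact secondSplit_ne_zero e hv0 hv (by omega) hh.2
  · exact firstSplit_ne_zero e hv0 hv hh.1 (by omega)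

omit hv0 hv hw0 hw [IsSimpleModule 𝒜 V] in
theorem E_smul_switching_smul (r : Fin (d + 1)) (x : V) :
    Φ.E r • Φ.switching e • x = Φ.switchingCoeff e r • Φ.E r • x := by
  rw [switching, Finset.sum_smul, Finset.smul_sum, Finset.sum_eq_single_of_mem r (Finset.mem_univ r)]
  · rw [smul_assoc, smul_comm (Φ.E r), smul_smul (Φ.E r), Φ.E_mul_self e]
    rfl
  · intro j _ hj
    rw [smul_assoc, smul_comm (Φ.E r), smul_smul (Φ.E r), Φ.E_mul_E_of_ne e hj.symm, zero_smul,
      smul_zero]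

/-- The switching element sends `E*_0 V` to `E*_d V`. -/
theorem exists_smul_switching_smul_eq : ∃ c : K, c ≠ 0 ∧ c • Φ.switching e • v = w := by
  have h : ∀ r, ∃ c : K, Φ.E r • w = c • Φ.E r • v := fun r =>
    Φ.exists_eq_smul_of_E_smul e (E_smul_ne_zero e hv0 hv r)
      (by rw [smul_smul, Φ.E_mul_self e]) (by rw [smul_smul, Φ.E_mul_self e])
  choose c hc using h
  have hw' : Φ.reverseEs.Es 0 • w = w := by
    change Φ.Es (Fin.rev 0) • w = w
    rwa [Fin.rev_zero]
  -- Dividing the identities for `w` and `v` eliminates the unknown block $E_nA^*E_{n+1}$. What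
  -- remains is the recurrence of `switchingCoeff_succ`, so the coordinates `c` are `c 0` times the
  -- coefficients of $S$.
  have hrec : ∀ n, n + 1 ≤ d → c (Fin.ofNat (d + 1) (n + 1)) * Φ.firstSplit e (n + 1) =
      Φ.secondSplit e (d - n) * c (Fin.ofNat (d + 1) n) := by
    intro n hn
    have h1 := E_smul_As_smul_E_succ_smul e hv0 hv hn
    have h2 : (Φ.τ (n + 1)).eval (Φ.θ (Fin.ofNat (d + 1) (n + 1))) •
      Φ.E (Fin.ofNat (d + 1) n) • Φ.As • Φ.E (Fin.ofNat (d + 1) (n + 1)) • w =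
    (Φ.reverseEs.firstSplit e (n + 1) * (Φ.τ n).eval (Φ.θ (Fin.ofNat (d + 1) n))) •
      Φ.E (Fin.ofNat (d + 1) n) • w :=
      E_smul_As_smul_E_succ_smul (Φ := Φ.reverseEs) e hw0 hw' hn
    rw [firstSplit_reverseEs e hv0 hv hw0 hw (by omega) hn, hc, hc, smul_comm Φ.As,
      smul_comm (Φ.E _), smul_comm (Polynomial.eval _ _), h1, smul_smul, smul_smul] at h2
    have h3 := smul_left_injective K (E_smul_ne_zero e hv0 hv (Fin.ofNat (d + 1) n)) h2
    have h4 : (Φ.τ n).eval (Φ.θ (Fin.ofNat (d + 1) n)) ≠ 0 :=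
      eval_τ_ne_zero (by rw [val_ofNat (by omega)])
    rw [show d + 1 - (n + 1) = d - n by omega] at h3
    refine mul_right_cancel₀ h4 ?_
    linear_combination h3
  have hcoeff : ∀ n, n ≤ d → c (Fin.ofNat (d + 1) n) = c 0 * Φ.switchingCoeff e n := by
    intro n
    induction n with
    | zero =>
      intro _
      rw [switchingCoeff_zero, mul_one]
      rfl
    | succ n ih =>
      intro hn
      refine mul_right_cancel₀ (firstSplit_ne_zero e hv0 hv (by omega) hn) ?_
      rw [hrec n hn, ih (by omega), mul_assoc, switchingCoeff_succ e hv0 hv hn]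
      ring
  refine ⟨c 0, ?_, ?_⟩
  · intro h0
    have := hc 0
    rw [h0, zero_smul] at this
    exact E_smul_ne_zero (Φ := Φ.reverseEs) e hw0 hw' 0 this
  · rw [← Φ.sum_E_smul e w, ← Φ.sum_E_smul e (c 0 • Φ.switching e • v)]
    refine Finset.sum_congr rfl fun r _ => ?_
    have := hcoeff r (by omega)
    rw [ofNat_val] at this
    rw [smul_comm (Φ.E r), E_smul_switching_smul e, smul_smul, hc, this]

theorem switching_smul_ne_zero : Φ.switching e • v ≠ 0 := by
  obtain ⟨c, -, hc⟩ := exists_smul_switching_smul_eq e hv0 hv hw0 hw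
  intro h
  rw [h, smul_zero] at hc
  exact hw0 hc.symm

theorem Es_last_smul_switching_smul :
    Φ.Es (Fin.last d) • Φ.switching e • v = Φ.switching e • v := by
  obtain ⟨c, hc0, hc⟩ := exists_smul_switching_smul_eq e hv0 hv hw0 hw
  have h : Φ.switching e • v = c⁻¹ • w := by rw [eq_inv_smul_iff₀ hc0, hc]
  rw [h, smul_comm (Φ.Es _), hw]

omit hw0 hw in
theorem isUnit_switching : IsUnit (Φ.switching e) := by
  let S' : 𝒜 := ∑ r : Fin (d + 1), (Φ.switchingCoeff e r)⁻¹ • Φ.E r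
  have key : ∀ a b : Fin (d + 1) → K, (∀ r, a r * b r = 1) →
      (∑ r, a r • Φ.E r) * (∑ r, b r • Φ.E r) = 1 := by
    intro a b hab
    rw [Finset.sum_mul, ← Φ.sum_E e]
    refine Finset.sum_congr rfl fun r _ => ?_
    rw [Finset.mul_sum, Finset.sum_eq_single_of_mem r (Finset.mem_univ r)]
    · rw [smul_mul_smul_comm, hab, Φ.E_mul_self e, one_smul]
    · intro j _ hj
      rw [smul_mul_smul_comm, Φ.E_mul_E_of_ne e hj.symm, smul_zero]
  have h0 : ∀ r : Fin (d + 1), Φ.switchingCoeff e r ≠ 0 := fun r =>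
    switchingCoeff_ne_zero e hv0 hv (by omega)
  exact ⟨⟨Φ.switching e, S', key _ _ fun r => mul_inv_cancel₀ (h0 r),
    key _ _ fun r => inv_mul_cancel₀ (h0 r)⟩, rfl⟩

omit [AddCommGroup V] [Module K V] [Module 𝒜 V] [IsScalarTower K 𝒜 V] [IsSimpleModule 𝒜 V]
  hv0 hv hw0 hw in
theorem commute_switching_A : Commute (Φ.switching e) Φ.A := by
  refine Commute.sum_left _ _ _ fun r _ => Commute.smul_left ?_ _
  rw [Commute, SemiconjBy, Φ.E_mul_A e, Φ.A_mul_E e]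

omit e hv0 hv hw0 hw [IsSimpleModule 𝒜 V] in
-- With $T=S$ this makes $S$ carry the split lines built on $E^*_0V$ to those built on $E^*_dV$.
theorem smul_splitVector_of_commute {T : 𝒜} (hT : Commute T Φ.A) (x : V) (i : ℕ) :
    T • Φ.splitVector x i = Φ.splitVector (T • x) i := by
  induction i with
  | zero => rw [splitVector_zero, splitVector_zero]
  | succ i ih =>
    have h : ∀ x : V, Φ.splitVector x (i + 1) =
        Φ.A • Φ.splitVector x i - Φ.θ (Fin.ofNat (d + 1) i) • Φ.splitVector x i := fun x => by
      rw [A_smul_splitVector, add_sub_cancel_left]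
    rw [h, h, smul_sub, smul_comm T (Φ.θ _), ih, smul_smul, hT.eq, mul_smul, ih]

omit hv0 hv hw0 hw [IsSimpleModule 𝒜 V] in
theorem switching_smul_of_E_smul {r : Fin (d + 1)} {x : V} (hx : Φ.E r • x = x) :
    Φ.switching e • x = Φ.switchingCoeff e r • x := by
  rw [← Φ.sum_E_smul e (Φ.switching e • x), Finset.sum_eq_single_of_mem r (Finset.mem_univ r),
    E_smul_switching_smul e, hx]
  intro j _ hj
  rw [E_smul_switching_smul e, Φ.E_smul_eq_zero_of_E_smul_eq_self e hj hx, smul_zero]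

end Parameters

end LeonardSystem

/-! ### Decompositions from triangular families of vectors. -/

/-- Back substitution in a triangular system. -/
theorem eq_zero_of_triangular {ι K V : Type*} [Field K] [AddCommGroup V] [Module K V]
    [LinearOrder ι] [Fintype ι] {P : ι → V →ₗ[K] V} {u : ι → V} (hne : ∀ m, P m (u m) ≠ 0)
    (hz : ∀ m j, j < m → P m (u j) = 0) {s : Set ι} (hs : IsUpperSet s) {c : ι → K}
    (h : ∀ m ∈ s, P m (∑ j, c j • u j) = 0) (m : ι) (hm : m ∈ s) : c m = 0 := by
  induction m using WellFoundedGT.induction with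
  | ind m ih =>
    have h1 := h m hm
    rw [map_sum, Finset.sum_eq_single_of_mem m (Finset.mem_univ m), map_smul, smul_eq_zero] at h1
    · exact h1.resolve_right (hne m)
    · intro j _ hj
      rcases lt_or_gt_of_ne hj with hlt | hlt
      · rw [map_smul, hz m j hlt, smul_zero]
      · rw [ih j hlt (hs hlt.le hm), zero_smul, map_zero]

theorem mem_iSup_span_of_eq_zero {ι K V : Type*} [Field K] [AddCommGroup V] [Module K V]
    [Fintype ι] {u : ι → V} {c : ι → K} {s : Set ι} (h : ∀ j ∉ s, c j = 0) :
    ∑ j, c j • u j ∈ ⨆ j ∈ s, Submodule.span K {u j} := by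
  refine Submodule.sum_mem _ fun j _ => ?_
  by_cases hj : j ∈ s
  · exact Submodule.mem_iSup_of_mem j (Submodule.mem_iSup_of_mem hj
      (Submodule.smul_mem _ _ (Submodule.mem_span_singleton_self _)))
  · rw [h j hj, zero_smul]
    exact zero_mem _

/-- Vectors that are lower triangular for one family of maps and upper triangular for another
induce a decomposition from the two corresponding flags. -/
theorem isInducedDecomposition_of_triangular {K V : Type*} [Field K] [AddCommGroup V] [Module K V]
    [FiniteDimensional K V] {d : ℕ} (hd : Module.finrank K V ≤ d + 1)
    {P Q : Fin (d + 1) → V →ₗ[K] V} {u : Fin (d + 1) → V}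
    (hPne : ∀ m, P m (u m) ≠ 0) (hPz : ∀ m j, j < m → P m (u j) = 0)
    (hQne : ∀ m, Q m (u m) ≠ 0) (hQz : ∀ m j, m < j → Q m (u j) = 0)
    {F F' U : Fin (d + 1) → Submodule K V}
    (hF : ∀ i x, x ∈ F i ↔ ∀ j, i < j → P j x = 0)
    (hF' : ∀ i x, x ∈ F' i ↔ ∀ j, j < i.rev → Q j x = 0)
    (hU : ∀ i, U i = Submodule.span K {u i}) : IsInducedDecomposition F F' U := by
  obtain rfl : U = fun i => Submodule.span K {u i} := funext hU
  have hu0 : ∀ i, u i ≠ 0 := fun i h => hPne i (by rw [h, map_zero])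
  have hli : LinearIndependent K u := by
    rw [Fintype.linearIndependent_iff]
    intro c hc i
    exact eq_zero_of_triangular hPne hPz isUpperSet_univ (fun m _ => by rw [hc, map_zero]) i trivial
  have hcard : Fintype.card (Fin (d + 1)) = Module.finrank K V :=
    le_antisymm hli.fintype_card_le_finrank (by simpa using hd)
  have htop : Submodule.span K (Set.range u) = ⊤ :=
    hli.span_eq_top_of_card_eq_finrank hcard
  have hex : ∀ x : V, ∃ c : Fin (d + 1) → K, ∑ j, c j • u j = x := fun x =>
    Submodule.mem_span_range_iff_exists_fun K |>.1 (htop ▸ Submodule.mem_top)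
  refine ⟨⟨fun i => finrank_span_singleton (hu0 i), ?_⟩, fun i => ?_, fun i => ?_⟩
  · refine DirectSum.isInternal_submodule_of_iSupIndep_of_iSup_eq_top
      hli.iSupIndep_span_singleton ?_
    rw [← htop, Submodule.span_range_eq_iSup]
  · refine le_antisymm (fun x hx => ?_) (iSup₂_le fun j hj => ?_)
    · obtain ⟨c, rfl⟩ := hex x
      refine mem_iSup_span_of_eq_zero fun j hj => ?_
      exact eq_zero_of_triangular hPne hPz (isUpperSet_Ioi i) ((hF i _).1 hx) j
        (lt_of_not_ge (α := Fin (d + 1)) hj)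
    · rw [Submodule.span_singleton_le_iff_mem, hF]
      exact fun k hk => hPz k j (lt_of_le_of_lt hj hk)
  · refine le_antisymm (fun x hx => ?_) (iSup₂_le fun j hj => ?_)
    · obtain ⟨c, rfl⟩ := hex x
      refine mem_iSup_span_of_eq_zero fun j hj => ?_
      -- The family is triangular the other way for `Q`, so back substitution runs in the dual
      -- order.
      exact eq_zero_of_triangular (ι := (Fin (d + 1))ᵒᵈ) (P := Q) (u := u) hQne hQz
        (isUpperSet_Ioi (OrderDual.toDual i.rev)) ((hF' i _).1 hx) j
        (lt_of_not_ge (α := Fin (d + 1)) hj)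
    · rw [Submodule.span_singleton_le_iff_mem, hF']
      exact fun k hk => hQz k j (lt_of_lt_of_le hk hj)

/-! ### Flags, and their components as split lines. -/

namespace LeonardSystem

section Flags

variable {K 𝒜 V : Type*} [Field K] [Ring 𝒜] [Algebra K 𝒜] {d : ℕ}
  {Φ : LeonardSystem K 𝒜 d} (e : 𝒜 ≃ₐ[K] Matrix (Fin (d + 1)) (Fin (d + 1)) K)
  [AddCommGroup V] [Module K V] [Module 𝒜 V] [IsScalarTower K 𝒜 V]

include e

/-- The $E_j$ are orthogonal idempotents with sum $1$. Flag membership thus becomes the vanishing of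
components, the form in which the split vectors are controlled. -/
theorem mem_iSup_imageSubspace {s : Set (Fin (d + 1))} {x : V} :
    x ∈ ⨆ j ∈ s, imageSubspace (K := K) V (Φ.E j) ↔ ∀ j ∉ s, Φ.E j • x = 0 := by
  constructor
  · intro hx j hj
    have hle : ⨆ j ∈ s, imageSubspace (K := K) V (Φ.E j) ≤ LinearMap.ker (Algebra.lsmul K K V (Φ.E j)) := by
      refine iSup₂_le fun k hk => ?_
      rintro _ ⟨y, rfl⟩
      exact Φ.E_smul_E_smul_of_ne e (fun h : j = k => hj (h ▸ hk)) y
    exact hle hx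
  · intro h
    rw [← Φ.sum_E_smul e x]
    refine Submodule.sum_mem _ fun j _ => ?_
    by_cases hj : j ∈ s
    · exact Submodule.mem_iSup_of_mem j (Submodule.mem_iSup_of_mem hj ⟨x, rfl⟩)
    · rw [h j hj]
      exact zero_mem _

theorem mem_flag_zero {i : Fin (d + 1)} {x : V} :
    x ∈ Φ.flag V .zero i ↔ ∀ j, i < j → Φ.E j • x = 0 := by
  simp only [flag]
  rw [mem_iSup_imageSubspace e]
  simp

theorem mem_flag_D {i : Fin (d + 1)} {x : V} :
    x ∈ Φ.flag V .D i ↔ ∀ j, j < i.rev → Φ.E j • x = 0 := by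
  simp only [flag]
  rw [mem_iSup_imageSubspace e]
  simp

theorem mem_flag_zeroStar {i : Fin (d + 1)} {x : V} :
    x ∈ Φ.flag V .zeroStar i ↔ ∀ j, i < j → Φ.Es j • x = 0 :=
  mem_flag_zero (Φ := Φ.dual) e

theorem mem_flag_DStar {i : Fin (d + 1)} {x : V} :
    x ∈ Φ.flag V .DStar i ↔ ∀ j, j < i.rev → Φ.Es j • x = 0 :=
  mem_flag_D (Φ := Φ.dual) e

theorem flag_D_reverseE : Φ.reverseE.flag V .D = Φ.flag V .zero := by
  ext i x
  rw [mem_flag_D e, mem_flag_zero e, ← Fin.revPerm.forall_congr_right]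
  simp [reverseE, Fin.rev_lt_rev]

theorem flag_zeroStar_reverseEs : Φ.reverseEs.flag V .zeroStar = Φ.flag V .DStar := by
  ext i x
  rw [mem_flag_zeroStar e, mem_flag_DStar e, ← Fin.revPerm.forall_congr_right]
  simp [reverseE, reverseEs, dual, Fin.lt_rev_iff]

variable [IsSimpleModule 𝒜 V] {v : V} (hv0 : v ≠ 0) (hv : Φ.Es 0 • v = v)
include hv0 hv

theorem component_eq_span (i : Fin (d + 1)) :
    Φ.component V .zeroStar .D i = Submodule.span K {Φ.splitVector v i} := by
  ext x
  rw [component, Submodule.mem_inf, mem_flag_zeroStar e, mem_flag_D e, Fin.rev_rev,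
    Submodule.mem_span_singleton]
  constructor
  · rintro ⟨h1, h2⟩
    obtain ⟨c, rfl⟩ := exists_eq_smul_aeval_τ_smul e hv0 hv (i := i) (by omega) h1 h2
    exact ⟨c, rfl⟩
  · rintro ⟨c, rfl⟩
    exact ⟨fun j hj => by rw [smul_comm, Es_smul_splitVector_eq_zero e hv hj, smul_zero],
      fun j hj => by rw [smul_comm, E_smul_splitVector_eq_zero e hj, smul_zero]⟩

theorem span_E_smul_eq_top : Submodule.span K (Set.range fun r => Φ.E r • v) = ⊤ := by
  rw [eq_top_iff]
  intro x _
  rw [← Φ.sum_E_smul e x]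
  refine Submodule.sum_mem _ fun r _ => ?_
  obtain ⟨c, hc⟩ := Φ.exists_eq_smul_of_E_smul e (E_smul_ne_zero e hv0 hv r)
    (by rw [smul_smul, Φ.E_mul_self e]) (x := Φ.E r • x) (by rw [smul_smul, Φ.E_mul_self e])
  rw [hc]
  exact Submodule.smul_mem _ _ (Submodule.subset_span ⟨r, rfl⟩)

theorem isInducedDecomposition : IsInducedDecomposition (Φ.flag V .zeroStar) (Φ.flag V .D)
    (Φ.component V .zeroStar .D) := by
  have htop := span_E_smul_eq_top e hv0 hv
  have : FiniteDimensional K V :=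
    Module.finite_def.2 ⟨(Set.finite_range fun r => Φ.E r • v).toFinset, by simpa using htop⟩
  have hd : Module.finrank K V ≤ d + 1 := by
    have := finrank_range_le_card (R := K) fun r => Φ.E r • v
    rwa [Set.finrank, htop, finrank_top, Fintype.card_fin] at this
  exact isInducedDecomposition_of_triangular hd (P := fun j => Algebra.lsmul K K V (Φ.Es j))
    (Q := fun j => Algebra.lsmul K K V (Φ.E j)) (u := fun i => Φ.splitVector v i)
    (fun m => Es_smul_splitVector_ne_zero e hv0 hv rfl)
    (fun m j h => Es_smul_splitVector_eq_zero e hv h)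
    (fun m => E_smul_splitVector_ne_zero e hv0 hv le_rfl)
    (fun m j h => E_smul_splitVector_eq_zero e h)
    (fun i x => mem_flag_zeroStar e) (fun i x => mem_flag_D e)
    (fun i => component_eq_span e hv0 hv i)

end Flags

/-! ### Each split line described from both ends, and the resulting cycle. -/

section Cycle

variable {K 𝒜 V : Type*} [Field K] [Ring 𝒜] [Algebra K 𝒜] {d : ℕ}
  {Φ : LeonardSystem K 𝒜 d} (e : 𝒜 ≃ₐ[K] Matrix (Fin (d + 1)) (Fin (d + 1)) K)
  [AddCommGroup V] [Module K V] [Module 𝒜 V] [IsScalarTower K 𝒜 V]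

theorem reverseE_reverseE : Φ.reverseE.reverseE = Φ := by
  cases Φ
  simp [reverseE, Function.comp_assoc, Fin.rev_involutive.comp_self]

theorem splitVector_smul (c : K) (x : V) (i : ℕ) :
    Φ.splitVector (c • x) i = c • Φ.splitVector x i :=
  smul_comm _ _ _

variable [IsSimpleModule 𝒜 V] {v : V} (hv0 : v ≠ 0) (hv : Φ.Es 0 • v = v)

include e hv0 hv

theorem exists_splitVector_d_eq {y : V} (hy0 : y ≠ 0) (hy : Φ.E (Fin.last d) • y = y) :
    ∃ a : K, a ≠ 0 ∧ Φ.splitVector v d = a • y := by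
  have h : Φ.E (Fin.last d) • Φ.splitVector v d = Φ.splitVector v d := by
    conv_rhs => rw [← Φ.sum_E_smul e (Φ.splitVector v d)]
    rw [Finset.sum_eq_single_of_mem (Fin.last d) (Finset.mem_univ _)]
    intro j _ hj
    exact E_smul_splitVector_eq_zero e (Fin.lt_last_iff_ne_last.2 hj)
  obtain ⟨a, ha⟩ := Φ.exists_eq_smul_of_E_smul e hy0 hy h
  refine ⟨a, ?_, ha⟩
  rintro rfl
  rw [zero_smul] at ha
  exact splitVector_ne_zero e hv0 hv le_rfl ha

/-- Start at the top vector $\tau_d(A)v$. Each successive factor $A^*-\theta^*_{d-k}$ lowers the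
index by one and contributes $\varphi_{d-k}$. -/
theorem reverseE_dual_splitVector {k : ℕ} (hk : k ≤ d) :
    Φ.dual.reverseE.splitVector (Φ.splitVector v d) k =
      (∏ h ∈ Finset.Icc (d - k + 1) d, Φ.firstSplit e h) • Φ.splitVector v (d - k) := by
  induction k with
  | zero => simp [splitVector_zero]
  | succ k ih =>
    have h1 := A_smul_splitVector (Φ := Φ.dual.reverseE) (v := Φ.splitVector v d) k
    change Φ.As • _ = Φ.θs (Fin.rev _) • _ + _ at h1
    have h2 : Finset.Icc (d - (k + 1) + 1) d = insert (d - k) (Finset.Icc (d - k + 1) d) := by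
      ext
      simp only [Finset.mem_Icc, Finset.mem_insert]
      omega
    have h3 := (firstSplit_spec e hv0 hv (i := d - (k + 1)) (by omega)).2
    rw [show d - (k + 1) + 1 = d - k by omega] at h3
    rw [rev_ofNat (by omega), ih (by omega), smul_comm Φ.As, h3, smul_add,
      smul_comm _ (Φ.θs _)] at h1
    rw [← add_left_cancel h1, h2, Finset.prod_insert (by simp), smul_smul, mul_comm]

theorem prod_firstSplit_smul_splitVector {y : V} {a : K} (ha : Φ.splitVector v d = a • y) {i : ℕ}
    (hi : i ≤ d) : (∏ h ∈ Finset.Icc (i + 1) d, Φ.firstSplit e h) • Φ.splitVector v i =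
      a • Φ.dual.reverseE.splitVector y (d - i) := by
  have h := reverseE_dual_splitVector e hv0 hv (k := d - i) (by omega)
  rwa [ha, splitVector_smul, show d - (d - i) = i by omega, eq_comm] at h

end Cycle

end LeonardSystem

/-- Two pairs of lines interchanged by `S` and by `T` form a cycle on which the commutators of
`S` and `T` act as scalars. -/
theorem commutator_smul_of_cycle {K G V : Type*} [Field K] [Group G] [AddCommGroup V] [Module K V]
    [MulAction G V] [SMulCommClass G K V] {S T : G} {u u' z z' X Y X' Y' : V}
    (hS : S • u = u') (hS' : S • z = z') (hT : T • X = Y) (hT' : T • X' = Y')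
    {α β γ δ a a' b : K} (hα0 : α ≠ 0) (hβ0 : β ≠ 0) (hγ0 : γ ≠ 0) (hδ0 : δ ≠ 0) (ha0 : a ≠ 0)
    (ha0' : a' ≠ 0) (hb0 : b ≠ 0) (hα : α • u' = a • Y) (hβ : β • u = a' • Y')
    (hγ : γ • z = b • X') (hδ : δ • z' = b • X) :
    T • S⁻¹ • T⁻¹ • S • u = (a * δ * β / (α * γ * a')) • u ∧
    T • S • T⁻¹ • S⁻¹ • u' = (a' * γ * α / (β * δ * a)) • u' ∧
    T⁻¹ • S⁻¹ • T • S • z = (a' * α * γ / (δ * a * β)) • z ∧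
    T⁻¹ • S • T • S⁻¹ • z' = (a * β * δ / (γ * a' * α)) • z' := by
  have swap : ∀ {p q : K} {x y : V}, p ≠ 0 → p • x = q • y → x = (q / p) • y := by
    intro p q x y hp h
    rw [div_eq_inv_mul, mul_smul, eq_inv_smul_iff₀ hp, h]
  have iS : S⁻¹ • u' = u := by rw [← hS, inv_smul_smul]
  have iS' : S⁻¹ • z' = z := by rw [← hS', inv_smul_smul]
  have iT : T⁻¹ • Y = X := by rw [← hT, inv_smul_smul]
  have iT' : T⁻¹ • Y' = X' := by rw [← hT', inv_smul_smul]
  have eu' := swap hα0 hα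
  have eY := swap ha0 hα.symm
  have eu := swap hβ0 hβ
  have eY' := swap ha0' hβ.symm
  have ez := swap hγ0 hγ
  have eX' := swap hb0 hγ.symm
  have ez' := swap hδ0 hδ
  have eX := swap hb0 hδ.symm
  -- The lines of $u=Y'$, $u'=Y$, $z'=X$ and $z=X'$ (equal up to scalars) are the corners of the
  -- square. Each product is evaluated as two half-turns; the common factor `b` cancels.
  refine ⟨?_, ?_, ?_, ?_⟩
  · have h1 : T⁻¹ • S • u = (a / α * (δ / b)) • z' := by
      rw [hS, eu', smul_comm, iT, eX, smul_smul]
    have h2 : T • z = (b / γ * (β / a')) • u := by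
      rw [ez, smul_comm, hT', eY', smul_smul]
    rw [h1, smul_comm S⁻¹, iS', smul_comm T, h2, smul_smul]
    congr 1
    field_simp
  · have h1 : T⁻¹ • S⁻¹ • u' = (a' / β * (γ / b)) • z := by
      rw [iS, eu, smul_comm, iT', eX', smul_smul]
    have h2 : T • z' = (b / δ * (α / a)) • u' := by
      rw [ez', smul_comm, hT, eY, smul_smul]
    rw [h1, smul_comm S, hS', smul_comm T, h2, smul_smul]
    congr 1
    field_simp
  · have h1 : T • S • z = (b / δ * (α / a)) • u' := by
      rw [hS', ez', smul_comm, hT, eY, smul_smul]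
    have h2 : T⁻¹ • u = (a' / β * (γ / b)) • z := by
      rw [eu, smul_comm, iT', eX', smul_smul]
    rw [h1, smul_comm S⁻¹, iS, smul_comm T⁻¹, h2, smul_smul]
    congr 1
    field_simp
  · have h1 : T • S⁻¹ • z' = (b / γ * (β / a')) • u := by
      rw [iS', ez, smul_comm, hT', eY', smul_smul]
    have h2 : T⁻¹ • u' = (a / α * (δ / b)) • z' := by
      rw [eu', smul_comm, iT, eX, smul_smul]
    rw [h1, smul_comm S, hS, smul_comm T⁻¹, h2, smul_smul]
    congr 1
    field_simp

/-! ### Split products and the final evaluation. -/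

namespace LeonardSystem

section Switching

variable {K 𝒜 V : Type*} [Field K] [Ring 𝒜] [Algebra K 𝒜] {d : ℕ}
  {Φ : LeonardSystem K 𝒜 d} (e : 𝒜 ≃ₐ[K] Matrix (Fin (d + 1)) (Fin (d + 1)) K)
  [AddCommGroup V] [Module K V] [Module 𝒜 V] [IsScalarTower K 𝒜 V] [IsSimpleModule 𝒜 V]
  {v w : V}

theorem prod_firstSplit_reverseE (i : ℕ) :
    ∏ h ∈ Finset.Icc (i + 1) d, Φ.reverseE.firstSplit e h =
      ∏ h ∈ Finset.Icc (i + 1) d, Φ.secondSplit e h :=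
  Finset.prod_congr rfl fun _ hh => (secondSplit_eq e (Finset.mem_Icc.1 hh).2).symm

theorem prod_secondSplit_reverseE {i : ℕ} :
    ∏ h ∈ Finset.Icc 1 (d - i), Φ.reverseE.secondSplit e h =
      ∏ h ∈ Finset.Icc 1 (d - i), Φ.firstSplit e h :=
  Finset.prod_congr rfl fun _ hh =>
    secondSplit_reverseE e ((Finset.mem_Icc.1 hh).2.trans (Nat.sub_le d i))

theorem prod_firstSplit_reverseEs (hv0 : v ≠ 0) (hv : Φ.Es 0 • v = v) (hw0 : w ≠ 0)
    (hw : Φ.Es (Fin.last d) • w = w) {i : ℕ} :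
    ∏ h ∈ Finset.Icc (i + 1) d, Φ.reverseEs.firstSplit e h =
      ∏ h ∈ Finset.Icc 1 (d - i), Φ.secondSplit e h := by
  refine Finset.prod_nbij' (fun h => d + 1 - h) (fun h => d + 1 - h) ?_ ?_ ?_ ?_ ?_ <;>
    intro h hh <;> rw [Finset.mem_Icc] at hh
  · rw [Finset.mem_Icc]; omega
  · rw [Finset.mem_Icc]; omega
  · omega
  · omega
  · exact firstSplit_reverseEs e hv0 hv hw0 hw (by omega) hh.2

theorem prod_Icc_mul_prod_Icc (f : ℕ → K) {i : ℕ} (hi : i ≤ d) :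
    (∏ h ∈ Finset.Icc 1 i, f h) * ∏ h ∈ Finset.Icc (i + 1) d, f h = ∏ h ∈ Finset.Icc 1 d, f h := by
  rw [← Finset.prod_union]
  · congr 1
    ext
    simp only [Finset.mem_union, Finset.mem_Icc]
    omega
  · rw [Finset.disjoint_left]
    intro h h1 h2
    rw [Finset.mem_Icc] at h1 h2
    omega

theorem isEigenvalueOn_span {X : 𝒜} {U : Submodule K V} {u : V} {c : K} (hu : u ≠ 0)
    (hU : U = Submodule.span K {u}) (h : X • u = c • u) : IsEigenvalueOn X U c := by
  subst hU
  refine ⟨by rwa [Ne, Submodule.span_singleton_eq_bot], fun x hx => ?_⟩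
  obtain ⟨a, rfl⟩ := Submodule.mem_span_singleton.1 hx
  rw [smul_comm X, h, smul_comm]

end Switching

end LeonardSystem

end

open LeonardSystem in
theorem theorem10p7 {K 𝒜 V : Type*} [Field K] [Ring 𝒜] [Algebra K 𝒜] (d : ℕ)
    (e : 𝒜 ≃ₐ[K] Matrix (Fin (d + 1)) (Fin (d + 1)) K)
    [AddCommGroup V] [Module K V] [Module 𝒜 V] [IsScalarTower K 𝒜 V] [IsSimpleModule 𝒜 V]
    (Φ : LeonardSystem K 𝒜 d) :
    IsInducedDecomposition (Φ.flag V .zeroStar) (Φ.flag V .D) (Φ.component V .zeroStar .D) ∧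
    IsInducedDecomposition (Φ.flag V .DStar) (Φ.flag V .D) (Φ.component V .DStar .D) ∧
    IsInducedDecomposition (Φ.flag V .zeroStar) (Φ.flag V .zero)
      (Φ.component V .zeroStar .zero) ∧
    IsInducedDecomposition (Φ.flag V .DStar) (Φ.flag V .zero) (Φ.component V .DStar .zero) ∧
    ∃ S Ss : 𝒜ˣ, (S : 𝒜) = Φ.switching e ∧ (Ss : 𝒜) = Φ.dualSwitching e ∧
      ∀ i : Fin (d + 1),
        IsEigenvalueOn ((Ss * S⁻¹ * Ss⁻¹ * S : 𝒜ˣ) : 𝒜) (Φ.component V .zeroStar .D i)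
          ((∏ h ∈ Finset.Icc 1 (i : ℕ), Φ.secondSplit e h) /
              (∏ h ∈ Finset.Icc 1 (i : ℕ), Φ.firstSplit e h) *
            ((∏ h ∈ Finset.Icc 1 (d - (i : ℕ)), Φ.firstSplit e h) /
              (∏ h ∈ Finset.Icc 1 (d - (i : ℕ)), Φ.secondSplit e h))) ∧
        IsEigenvalueOn ((Ss * S * Ss⁻¹ * S⁻¹ : 𝒜ˣ) : 𝒜) (Φ.component V .DStar .D i)
          ((∏ h ∈ Finset.Icc (d - (i : ℕ) + 1) d, Φ.firstSplit e h) /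
              (∏ h ∈ Finset.Icc (d - (i : ℕ) + 1) d, Φ.secondSplit e h) *
            ((∏ h ∈ Finset.Icc ((i : ℕ) + 1) d, Φ.secondSplit e h) /
              (∏ h ∈ Finset.Icc ((i : ℕ) + 1) d, Φ.firstSplit e h))) ∧
        IsEigenvalueOn ((Ss⁻¹ * S⁻¹ * Ss * S : 𝒜ˣ) : 𝒜) (Φ.component V .zeroStar .zero i)
          ((∏ h ∈ Finset.Icc 1 (i : ℕ), Φ.firstSplit e h) /
              (∏ h ∈ Finset.Icc 1 (i : ℕ), Φ.secondSplit e h) *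
            ((∏ h ∈ Finset.Icc 1 (d - (i : ℕ)), Φ.secondSplit e h) /
              (∏ h ∈ Finset.Icc 1 (d - (i : ℕ)), Φ.firstSplit e h))) ∧
        IsEigenvalueOn ((Ss⁻¹ * S * Ss * S⁻¹ : 𝒜ˣ) : 𝒜) (Φ.component V .DStar .zero i)
          ((∏ h ∈ Finset.Icc (d - (i : ℕ) + 1) d, Φ.secondSplit e h) /
              (∏ h ∈ Finset.Icc (d - (i : ℕ) + 1) d, Φ.firstSplit e h) *
            ((∏ h ∈ Finset.Icc ((i : ℕ) + 1) d, Φ.firstSplit e h) /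
              (∏ h ∈ Finset.Icc ((i : ℕ) + 1) d, Φ.secondSplit e h))) := by
  obtain ⟨v, hv0, hv⟩ := Φ.dual.exists_E_smul_eq_self e (V := V) 0
  obtain ⟨x, hx0, hx⟩ := Φ.exists_E_smul_eq_self e (V := V) 0
  obtain ⟨w', hw0', hw'⟩ := Φ.dual.exists_E_smul_eq_self e (V := V) (Fin.last d)
  obtain ⟨y', hy0', hy'⟩ := Φ.exists_E_smul_eq_self e (V := V) (Fin.last d)
  change Φ.Es 0 • v = v at hv
  change Φ.Es (Fin.last d) • w' = w' at hw'
  have hw0 := switching_smul_ne_zero e hv0 hv hw0' hw'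
  have hw := Es_last_smul_switching_smul e hv0 hv hw0' hw'
  have hy0 := switching_smul_ne_zero (Φ := Φ.dual) e hx0 hx hy0' hy'
  have hy : Φ.E (Fin.last d) • Φ.dual.switching e • x = Φ.dual.switching e • x :=
    Es_last_smul_switching_smul (Φ := Φ.dual) e hx0 hx hy0' hy'
  -- The vectors `w'` and `y'` served only to show that $Sv$ and $S^*x$ lie in $E^*_dV$ and $E_dV$.
  -- Taking `w` and `y` to be these images makes the switching maps exact, with no extra scalars.
  set w := Φ.switching e • v with hwdef
  set y := Φ.dual.switching e • x with hydef
  have hwr : Φ.reverseEs.Es 0 • w = w := by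
    change Φ.Es (Fin.rev 0) • w = w
    rwa [Fin.rev_zero]
  have hxr : Φ.reverseE.E (Fin.last d) • x = x := by
    change Φ.E (Fin.rev (Fin.last d)) • x = x
    rwa [Fin.rev_last]
  have hc1 := component_eq_span e hv0 hv
  have hc2 : ∀ i, Φ.component V .DStar .D i = Submodule.span K {Φ.splitVector w i} := fun i => by
    have := component_eq_span (Φ := Φ.reverseEs) e hw0 hwr i
    rwa [component, flag_zeroStar_reverseEs e] at this
  have hc3 : ∀ i, Φ.component V .zeroStar .zero i =
      Submodule.span K {Φ.reverseE.splitVector v i} := fun i => by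
    have := component_eq_span (Φ := Φ.reverseE) e hv0 hv i
    rwa [component, flag_D_reverseE e] at this
  have hc4 : ∀ i, Φ.component V .DStar .zero i =
      Submodule.span K {Φ.reverseE.splitVector w i} := fun i => by
    have := component_eq_span (Φ := Φ.reverseE.reverseEs) e hw0 hwr i
    rw [component, flag_zeroStar_reverseEs e] at this
    change Φ.flag V .DStar i ⊓ Φ.reverseE.flag V .D i.rev = _ at this
    rwa [flag_D_reverseE e] at this
  refine ⟨isInducedDecomposition e hv0 hv, ?_, ?_, ?_, ?_⟩
  · have := isInducedDecomposition (Φ := Φ.reverseEs) e hw0 hwr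
    unfold component at this
    rwa [flag_zeroStar_reverseEs e] at this
  · have := isInducedDecomposition (Φ := Φ.reverseE) e hv0 hv
    unfold component at this
    rwa [flag_D_reverseE e] at this
  · have := isInducedDecomposition (Φ := Φ.reverseE.reverseEs) e hw0 hwr
    unfold component at this
    rw [flag_zeroStar_reverseEs e] at this
    change IsInducedDecomposition (Φ.flag V .DStar) (Φ.reverseE.flag V .D)
      (fun i => Φ.flag V .DStar i ⊓ Φ.reverseE.flag V .D i.rev) at this
    rwa [flag_D_reverseE e] at this
  obtain ⟨S, hS⟩ := isUnit_switching e hv0 hv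
  obtain ⟨Ss, hSs⟩ := isUnit_switching (Φ := Φ.dual) e hx0 hx
  refine ⟨S, Ss, hS, hSs, fun i => ?_⟩
  have hi : (i : ℕ) ≤ d := by omega
  obtain ⟨a', ha0', ha'⟩ := exists_splitVector_d_eq e hv0 hv hy0 hy
  obtain ⟨b, hb0, hb⟩ := exists_splitVector_d_eq (Φ := Φ.reverseE) e hv0 hv hx0 hxr
  have hSE : ∀ n, S • Φ.splitVector v n = Φ.splitVector w n := fun n => by
    rw [Units.smul_def, hS, smul_splitVector_of_commute (commute_switching_A e)]
  have hSE' : ∀ n, S • Φ.reverseE.splitVector v n = Φ.reverseE.splitVector w n := fun n => by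
    rw [Units.smul_def, hS]
    exact smul_splitVector_of_commute (Φ := Φ.reverseE) (commute_switching_A (Φ := Φ) e) v n
  have hT : ∀ n, Ss • Φ.dual.splitVector x n = Φ.dual.splitVector y n := fun n => by
    rw [Units.smul_def, hSs, smul_splitVector_of_commute (commute_switching_A e)]
  have hT' : ∀ n, Ss • Φ.dual.reverseE.splitVector x n = Φ.dual.reverseE.splitVector y n :=
    fun n => by
      rw [Units.smul_def, hSs]
      exact smul_splitVector_of_commute (Φ := Φ.dual.reverseE)
        (commute_switching_A (Φ := Φ.dual) e) x n
  -- $S$ multiplies $E_dV$ by its last coefficient and fixes $E_0V$ pointwise. Hence replacing `v`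
  -- by `w` changes the constant `a'` by that coefficient, but leaves `b` unchanged.
  have ha : Φ.reverseEs.splitVector w d = (Φ.switchingCoeff e d * a') • y := by
    change Φ.splitVector w d = _
    rw [← hSE, ha', Units.smul_def, hS, smul_comm, switching_smul_of_E_smul e hy, smul_smul,
      mul_comm, Fin.val_last]
  have hb' : Φ.reverseE.reverseEs.splitVector w d = b • x := by
    change Φ.reverseE.splitVector w d = _
    rw [← hSE', hb, Units.smul_def, hS, smul_comm, switching_smul_of_E_smul e hx, Fin.val_zero,
      switchingCoeff_zero, one_smul]
  have e1 := prod_firstSplit_smul_splitVector (Φ := Φ.reverseEs) e hw0 hwr ha hi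
  have e2 := prod_firstSplit_smul_splitVector e hv0 hv ha' hi
  have e3 := prod_firstSplit_smul_splitVector (Φ := Φ.reverseE) e hv0 hv hb hi
  have e4 := prod_firstSplit_smul_splitVector (Φ := Φ.reverseE.reverseEs) e hw0 hwr hb' hi
  rw [prod_firstSplit_reverseEs e hv0 hv hw0 hw] at e1
  rw [prod_firstSplit_reverseE] at e3
  rw [prod_firstSplit_reverseEs (Φ := Φ.reverseE) e hv0 hv hw0 hw,
    prod_secondSplit_reverseE] at e4
  change _ • Φ.splitVector w i = _ • Φ.dual.reverseE.reverseE.splitVector y (d - i) at e1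
  change _ • Φ.reverseE.splitVector v i = _ • Φ.dual.reverseE.splitVector x (d - i) at e3
  change _ • Φ.reverseE.splitVector w i = _ • Φ.dual.reverseE.reverseE.splitVector x (d - i) at e4
  rw [reverseE_reverseE] at e1 e4
  have hφ : ∀ m n : ℕ, 1 ≤ m → n ≤ d → ∏ h ∈ Finset.Icc m n, Φ.firstSplit e h ≠ 0 :=
    fun m n hm hn => Finset.prod_ne_zero_iff.2 fun h hh => by
      rw [Finset.mem_Icc] at hh
      exact firstSplit_ne_zero e hv0 hv (by omega) (by omega)
  have hϕ : ∀ m n : ℕ, 1 ≤ m → n ≤ d → ∏ h ∈ Finset.Icc m n, Φ.secondSplit e h ≠ 0 :=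
    fun m n hm hn => Finset.prod_ne_zero_iff.2 fun h hh => by
      rw [Finset.mem_Icc] at hh
      exact secondSplit_ne_zero e hv0 hv (by omega) (by omega)
  have hsd : Φ.switchingCoeff e d =
      (∏ h ∈ Finset.Icc 1 d, Φ.secondSplit e h) / ∏ h ∈ Finset.Icc 1 d, Φ.firstSplit e h := by
    rw [switchingCoeff, Nat.sub_self]
  obtain ⟨c1, c2, c3, c4⟩ := commutator_smul_of_cycle (hSE i) (hSE' i) (hT (d - i)) (hT' (d - i))
    (hϕ _ _ le_rfl (by omega)) (hφ _ _ (by omega) le_rfl) (hϕ _ _ (by omega) le_rfl)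
    (hφ _ _ le_rfl (by omega)) (mul_ne_zero (switchingCoeff_ne_zero e hv0 hv le_rfl) ha0') ha0' hb0
    e1 e2 e3 e4
  have p1 := prod_Icc_mul_prod_Icc (Φ.firstSplit e) hi
  have p2 := prod_Icc_mul_prod_Icc (Φ.firstSplit e) (Nat.sub_le d i)
  have q1 := prod_Icc_mul_prod_Icc (Φ.secondSplit e) hi
  have q2 := prod_Icc_mul_prod_Icc (Φ.secondSplit e) (Nat.sub_le d i)
  have n1 := hφ 1 i le_rfl hi
  have n2 := hφ (i + 1) d (by omega) le_rfl
  have n3 := hφ 1 (d - i) le_rfl (by omega)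
  have n4 := hφ (d - i + 1) d (by omega) le_rfl
  have m1 := hϕ 1 i le_rfl hi
  have m2 := hϕ (i + 1) d (by omega) le_rfl
  have m3 := hϕ 1 (d - i) le_rfl (by omega)
  have m4 := hϕ (d - i + 1) d (by omega) le_rfl
  refine ⟨isEigenvalueOn_span (splitVector_ne_zero e hv0 hv hi) (hc1 i) ?_,
    isEigenvalueOn_span (splitVector_ne_zero (Φ := Φ.reverseEs) e hw0 hwr hi) (hc2 i) ?_,
    isEigenvalueOn_span (splitVector_ne_zero (Φ := Φ.reverseE) e hv0 hv hi) (hc3 i) ?_,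
    isEigenvalueOn_span (splitVector_ne_zero (Φ := Φ.reverseE.reverseEs) e hw0 hwr hi) (hc4 i) ?_⟩
  -- The last coefficient of $S$ is a quotient of full products over $1,\dots,d$. Splitting these at
  -- $i$ on the lines over $0^*$, and at $d-i$ on those over $D^*$, gives the stated cancellation.
  · rw [← Units.smul_def, mul_smul, mul_smul, mul_smul, c1, hsd, ← p1, ← q1]
    congr 1
    field_simp
  · change _ • Φ.splitVector w i = _ • Φ.splitVector w i
    rw [← Units.smul_def, mul_smul, mul_smul, mul_smul, c2, hsd, ← p2, ← q2]
    congr 1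
    field_simp
  · rw [← Units.smul_def, mul_smul, mul_smul, mul_smul, c3, hsd, ← p1, ← q1]
    congr 1
    field_simp
  · change _ • Φ.reverseE.splitVector w i = _ • Φ.reverseE.splitVector w i
    rw [← Units.smul_def, mul_smul, mul_smul, mul_smul, c4, hsd, ← p2, ← q2]
    congr 1
    field_simp
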